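/- A \emph{contact$^-$ poset} is a structure $(P,0,\le,\delta)$ where $(P,\le)$ is a partially ordered set with minimum $0$ and $\delta$ is a binary relation on $P$ such that, for all $a,b,a_1,b_1,n\in P$: (Sym) $a\mathrel\delta b \Leftrightarrow b\mathrel\delta a$; (Emp) $a\mathrel\delta b \Rightarrow a>0$ and $b>0$; (Ext) $a\mathrel\delta b$, $a\le a_1$ and $b\le b_1$ imply $a_1\mathrel\delta b_1$; (Ref) $n\ne 0\Rightarrow n\mathrel\delta n$. A (not necessarily additive) \emph{contact$^-$ semilattice} is a structure $(P,0,+,\delta)$ where $(P,+)$ is a join semilattice with minimum $0$, ordered by $a\le b\Leftrightarrow a+b=b$, and $\delta$ satisfies the same four conditions. Let $T$ be either the first-order theory of contact$^-$ posets in the language $\{0,\le,\delta\}$ or the first-order theory of contact$^-$ semilattices in the language $\{0,+,\delta\}$; embeddings are the model-theoretic ones. \textbf{Theorem 5.} In each of the two cases the following hold. (1) The class of models of $T$ has the superamalgamation property: for all models $A,B,C$ of $T$ and embeddings $f:C\to A$, $g:C\to B$ there are a model $D$ of $T$ and embeddings $h:A\to D$, $k:B\to D$ with $hf=kg$ and $h(A)\cap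 k(B)=hf(C)$, such that for all $a\in A$ and $b\in B$: if $h(a)\le k(b)$, then there is $c\in C$ with $a\le f(c)$ and $g(c)\le b$; and if $k(b)\le h(a)$, then there is $c\in C$ with $b\le g(c)$ and $f(c)\le a$. (2) The class of finite models of $T$ has a Fraïssé limit $M$, that is, a countable ultrahomogeneous structure whose finitely generated substructures are, up to isomorphism, exactly the finite models of $T$. (3) The first-order theory $\mathrm{Th}(M)$ is $\omega$-categorical (it has exactly one countably infinite model up to isomorphism), has quantifier elimination, and is the model completion of $T$: it is a model complete theory extending $T$, every model of $T$ embeds in a model of $\mathrm{Th}(M)$, and for every model $A$ of $T$ the theory $\mathrm{Th}(M)\cup\mathrm{Diag}(A)$ is complete, where $\mathrm{Diag}(A)$ is the diagram of $A$, i.e. the set of atomic and negated atomic sentences, with constants for the elements of $A$, which are true in $A$. -/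

import Mathlib

universe u v w

open FirstOrder FirstOrder.Language CategoryTheory
open scoped FirstOrder

/-! ### General model theory -/

namespace FirstOrder.Language

/-- The superamalgamation property for the class of models of `T`, where `le` is the order carried
by the models: two extensions `A`, `B` of a common model `C` can be jointly embedded in a model `D`,
so that they agree on `C`, the images of `A` and `B` meet exactly in the image of `C`, and each
inequality in `D` between an element of `A` and one of `B` is witnessed by an element of `C`. -/
def Superamalgamation {L : Language.{u, v}} (T : L.Theory)
    (le : ∀ (M : Type w) [L.Structure M], M → M → Prop) : Prop :=
  ∀ (A B C : Bundled.{w} L.Structure), A ⊨ T → B ⊨ T → C ⊨ T →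
    ∀ (f : C ↪[L] A) (g : C ↪[L] B),
      ∃ (D : Bundled.{w} L.Structure) (h : A ↪[L] D) (k : B ↪[L] D),
        D ⊨ T ∧
        (∀ c : C, h (f c) = k (g c)) ∧
        (∀ (a : A) (b : B), h a = k b → ∃ c : C, f c = a ∧ g c = b) ∧
        (∀ (a : A) (b : B), le D (h a) (k b) → ∃ c : C, le A a (f c) ∧ le B (g c) b) ∧
        (∀ (a : A) (b : B), le D (k b) (h a) → ∃ c : C, le B b (g c) ∧ le A (f c) a)

/-- The class of finite models of a theory. -/
def finiteModels {L : Language.{u, v}} (T : L.Theory) : Set (Bundled.{w} L.Structure) :=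
  {S | Finite S ∧ S ⊨ T}

namespace Theory

variable {L : Language.{u, v}}

/-- A theory is `ω`-categorical if it has exactly one model of cardinality `ℵ₀`, up to
isomorphism. -/
def IsOmegaCategorical (T : L.Theory) : Prop :=
  (∃ M : ModelType.{u, v, w} T, Cardinal.mk M = Cardinal.aleph0) ∧
    Cardinal.Categorical (Cardinal.aleph0 : Cardinal.{w}) T

/-- A theory has quantifier elimination if, modulo the theory, each formula is equivalent to a
quantifier-free formula in the same free variables. -/
def HasQuantifierElimination (T : L.Theory) : Prop :=
  ∀ (n : ℕ) (φ : L.Formula (Fin n)), ∃ ψ : L.Formula (Fin n), ψ.IsQF ∧ T ⊨ᵇ φ.iff ψ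

/-- A theory is model complete if each embedding between its models is elementary. -/
def IsModelComplete (T : L.Theory) : Prop :=
  ∀ (M N : ModelType.{u, v, w} T) (f : M ↪[L] N) (n : ℕ) (φ : L.Formula (Fin n)) (x : Fin n → M),
    φ.Realize (f ∘ x) ↔ φ.Realize x

/-- The diagram of `A`: the atomic and negated atomic sentences, with a constant for each element
of `A`, which hold in `A`. -/
def diagram (L : Language.{u, v}) (A : Type w) [L.Structure A] : L[[A]].Theory :=
  {φ | A ⊨ φ ∧ (φ.IsAtomic ∨ ∃ ψ : L[[A]].Sentence, ψ.IsAtomic ∧ φ = ψ.not)}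

/-- `T'` is the model completion of `T`: it is a model complete theory extending `T`, each model of
`T` can be embedded in a model of `T'`, and `T'` together with the diagram of any model of `T`
is a complete theory. -/
structure IsModelCompletion (T' T : L.Theory) : Prop where
  extends_base : ∀ φ ∈ T, T' ⊨ᵇ φ
  modelComplete : IsModelComplete.{u, v, w} T'
  exists_embedding : ∀ A : ModelType.{u, v, w} T,
    ∃ N : ModelType.{u, v, w} T', Nonempty (A ↪[L] N)
  complete_diagram : ∀ A : ModelType.{u, v, w} T,
    ((L.lhomWithConstants A).onTheory T' ∪ diagram L A).IsComplete

end Theory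

end FirstOrder.Language

/-! ### Contact posets -/

namespace ContactPoset

/-- The function symbols of contact posets: a constant for the minimum. -/
inductive Func : ℕ → Type
  | zero : Func 0

/-- The relation symbols of contact posets: the order and the contact relation. -/
inductive Rel : ℕ → Type
  | le : Rel 2
  | contact : Rel 2

/-- The language of contact posets, with symbols `0`, `≤`, `δ`. -/
def lang : FirstOrder.Language.{0, 0} := ⟨Func, Rel⟩

/-- The symbol `0`. -/
def zeroSymb : lang.Constants := Func.zero

/-- The symbol `≤`. -/
def leSymb : lang.Relations 2 := Rel.le

/-- The symbol `δ`. -/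
def contactSymb : lang.Relations 2 := Rel.contact

instance : Countable (Σ l, lang.Functions l) :=
  Function.Injective.countable (f := fun _ => ()) (by rintro ⟨_, ⟨⟩⟩ ⟨_, ⟨⟩⟩ _; rfl)

/-- The minimum. -/
def zero (M : Type w) [lang.Structure M] : M := (zeroSymb : M)

/-- The order. -/
def Le (M : Type w) [lang.Structure M] (a b : M) : Prop :=
  Structure.RelMap leSymb ![a, b]

/-- The contact relation. -/
def Contact (M : Type w) [lang.Structure M] (a b : M) : Prop :=
  Structure.RelMap contactSymb ![a, b]

section Formulas

variable {n : ℕ}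

/-- The term `0`. -/
def zeroT : lang.Term (Empty ⊕ Fin n) := Constants.term zeroSymb

/-- The formula `s ≤ t`. -/
def leF (s t : lang.Term (Empty ⊕ Fin n)) : lang.BoundedFormula Empty n :=
  Relations.boundedFormula₂ leSymb s t

/-- The formula `s < t`. -/
def ltF (s t : lang.Term (Empty ⊕ Fin n)) : lang.BoundedFormula Empty n :=
  leF s t ⊓ ∼(s =' t)

/-- The formula `s δ t`. -/
def conF (s t : lang.Term (Empty ⊕ Fin n)) : lang.BoundedFormula Empty n :=
  Relations.boundedFormula₂ contactSymb s t

end Formulas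

/-- The theory of (not necessarily additive) contact posets with `0`. In turn: reflexivity,
transitivity, antisymmetry, minimum, (Sym), (Emp), (Ext), (Ref). -/
def theory : lang.Theory :=
  {∀' leF (&0) (&0),
   ∀' ∀' ∀' (leF (&0) (&1) ⊓ leF (&1) (&2) ⟹ leF (&0) (&2)),
   ∀' ∀' (leF (&0) (&1) ⊓ leF (&1) (&0) ⟹ (&0 =' &1)),
   ∀' leF zeroT (&0),
   ∀' ∀' (conF (&0) (&1) ⇔ conF (&1) (&0)),
   ∀' ∀' (conF (&0) (&1) ⟹ ltF zeroT (&0) ⊓ ltF zeroT (&1)),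
   ∀' ∀' ∀' ∀' (conF (&0) (&1) ⊓ leF (&0) (&2) ⊓ leF (&1) (&3) ⟹ conF (&2) (&3)),
   ∀' (∼(&0 =' zeroT) ⟹ conF (&0) (&0))}

/-- The models of the theory are exactly the contact posets. -/
theorem model_theory_iff (M : Type w) [lang.Structure M] :
    M ⊨ theory ↔
      (∀ a, Le M a a) ∧
      (∀ a b c, Le M a b → Le M b c → Le M a c) ∧
      (∀ a b, Le M a b → Le M b a → a = b) ∧
      (∀ a, Le M (zero M) a) ∧
      (∀ a b, Contact M a b ↔ Contact M b a) ∧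
      (∀ a b, Contact M a b →
        (Le M (zero M) a ∧ zero M ≠ a) ∧ (Le M (zero M) b ∧ zero M ≠ b)) ∧
      (∀ a b a₁ b₁, Contact M a b → Le M a a₁ → Le M b b₁ → Contact M a₁ b₁) ∧
      (∀ a, a ≠ zero M → Contact M a a) := by
  simp [theory, Theory.model_iff, Sentence.Realize, Formula.Realize, leF, ltF, conF, zeroT,
    BoundedFormula.realize_rel₂, Term.realize_constants, Fin.snoc, Le, Contact, zero]

end ContactPoset

/-! ### Contact semilattices -/

namespace ContactSemilattice

/-- The function symbols of contact semilattices: a constant for the minimum, and the join. -/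
inductive Func : ℕ → Type
  | zero : Func 0
  | add : Func 2

/-- The relation symbol of contact semilattices: the contact relation. -/
inductive Rel : ℕ → Type
  | contact : Rel 2

/-- The language of contact semilattices, with symbols `0`, `+`, `δ`. -/
def lang : FirstOrder.Language.{0, 0} := ⟨Func, Rel⟩

/-- The symbol `0`. -/
def zeroSymb : lang.Constants := Func.zero

/-- The symbol `+`. -/
def addSymb : lang.Functions 2 := Func.add

/-- The symbol `δ`. -/
def contactSymb : lang.Relations 2 := Rel.contact

instance : Countable (Σ l, lang.Functions l) :=
  Function.Injective.countable (f := fun s => s.1)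
    (by rintro ⟨_, ⟨⟩⟩ ⟨_, ⟨⟩⟩ h <;> first | rfl | simp at h)

/-- The minimum. -/
def zero (M : Type w) [lang.Structure M] : M := (zeroSymb : M)

/-- The join. -/
def add (M : Type w) [lang.Structure M] (a b : M) : M :=
  Structure.funMap addSymb ![a, b]

/-- The order associated to the join. -/
def Le (M : Type w) [lang.Structure M] (a b : M) : Prop := add M a b = b

/-- The contact relation. -/
def Contact (M : Type w) [lang.Structure M] (a b : M) : Prop :=
  Structure.RelMap contactSymb ![a, b]

section Formulas

variable {n : ℕ}

/-- The term `0`. -/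
def zeroT : lang.Term (Empty ⊕ Fin n) := Constants.term zeroSymb

/-- The term `s + t`. -/
def addT (s t : lang.Term (Empty ⊕ Fin n)) : lang.Term (Empty ⊕ Fin n) :=
  Functions.apply₂ addSymb s t

/-- The formula `s ≤ t`, that is, `s + t = t`. -/
def leF (s t : lang.Term (Empty ⊕ Fin n)) : lang.BoundedFormula Empty n := addT s t =' t

/-- The formula `s < t`. -/
def ltF (s t : lang.Term (Empty ⊕ Fin n)) : lang.BoundedFormula Empty n :=
  leF s t ⊓ ∼(s =' t)

/-- The formula `s δ t`. -/
def conF (s t : lang.Term (Empty ⊕ Fin n)) : lang.BoundedFormula Empty n :=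
  Relations.boundedFormula₂ contactSymb s t

end Formulas

/-- The theory of (not necessarily additive) contact join semilattices with `0`. In turn:
associativity, commutativity, idempotence, minimum, (Sym), (Emp), (Ext), (Ref). -/
def theory : lang.Theory :=
  {∀' ∀' ∀' (addT (addT (&0) (&1)) (&2) =' addT (&0) (addT (&1) (&2))),
   ∀' ∀' (addT (&0) (&1) =' addT (&1) (&0)),
   ∀' (addT (&0) (&0) =' &0),
   ∀' leF zeroT (&0),
   ∀' ∀' (conF (&0) (&1) ⇔ conF (&1) (&0)),
   ∀' ∀' (conF (&0) (&1) ⟹ ltF zeroT (&0) ⊓ ltF zeroT (&1)),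
   ∀' ∀' ∀' ∀' (conF (&0) (&1) ⊓ leF (&0) (&2) ⊓ leF (&1) (&3) ⟹ conF (&2) (&3)),
   ∀' (∼(&0 =' zeroT) ⟹ conF (&0) (&0))}

/-- The models of the theory are exactly the contact semilattices. -/
theorem model_theory_iff (M : Type w) [lang.Structure M] :
    M ⊨ theory ↔
      (∀ a b c, add M (add M a b) c = add M a (add M b c)) ∧
      (∀ a b, add M a b = add M b a) ∧
      (∀ a, add M a a = a) ∧
      (∀ a, Le M (zero M) a) ∧
      (∀ a b, Contact M a b ↔ Contact M b a) ∧
      (∀ a b, Contact M a b →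
        (Le M (zero M) a ∧ zero M ≠ a) ∧ (Le M (zero M) b ∧ zero M ≠ b)) ∧
      (∀ a b a₁ b₁, Contact M a b → Le M a a₁ → Le M b b₁ → Contact M a₁ b₁) ∧
      (∀ a, a ≠ zero M → Contact M a a) := by
  simp [theory, Theory.model_iff, Sentence.Realize, Formula.Realize, leF, ltF, conF, zeroT, addT,
    BoundedFormula.realize_rel₂, Term.realize_functions_apply₂, Term.realize_constants, Fin.snoc,
    Le, add, Contact, zero]

end ContactSemilattice

/-! Amalgamation comes from one explicit construction. Given `A` and `B` over `C`, take the pairs of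
lower sets of `A` and `B` that contain the minima and have the same trace on `C`, ordered by
inclusion; two pairs are in contact when elements of their `A`-parts, or of their `B`-parts, are. An
element `a` goes to the least pair containing it, so a pair lies above its image exactly when it
contains `a` (`Compatible.inl_le_iff`). A cross inequality is therefore a membership, and membership
in the part on the other side means an interpolant in `C`. No new contacts appear between elements
of `A` (`contact_inl`): a contact on the `B` side is pushed up to `C` by (Ext), and from there up in
`A`. For semilattices, the pairs are restricted to ideals; the embeddings then preserve joins,
because an ideal contains a join exactly when it contains both terms.

The rest is general (`exists_isFraisseLimit_isModelCompletion`). The theories are universal, in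
finite languages, and the value of a term is the join of its variables, so `n` generators give a
number of elements bounded in terms of `n`. Finite models thus form a Fraïssé class; the joint
embedding property is amalgamation over the one-element model, and the limit is a direct limit of a
sequence that solves all extension problems.

In the limit `M`, each atomic type of an `n`-tuple is isolated by one quantifier-free formula, and
homogeneity makes tuples of the same type conjugate: this gives quantifier elimination. Elimination
yields model completeness, the back-and-forth step behind categoricity, and completeness over a
diagram. An arbitrary model of `T` embeds in an ultrapower of `M`, since its finitely generated
substructures are finite models and so embed in `M`. -/

/-! ### Atomic types of tuples -/

namespace FirstOrder.Language

open Structure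

section AtomicType

variable {L : Language.{u, v}} {α : Type*}
variable {M : Type*} [L.Structure M] {N : Type*} [L.Structure N]

/-- Two tuples have the same atomic type if they satisfy the same atomic formulas. -/
structure SameAtomicType (L : Language.{u, v}) {M : Type*} [L.Structure M] {N : Type*}
    [L.Structure N] (x : α → M) (y : α → N) : Prop where
  equal : ∀ s t : L.Term α, s.realize x = t.realize x ↔ s.realize y = t.realize y
  rel : ∀ {k : ℕ} (R : L.Relations k) (ts : Fin k → L.Term α),
    RelMap R (fun i => (ts i).realize x) ↔ RelMap R (fun i => (ts i).realize y)

theorem exists_term_realize_of_mem_closure {x : α → M} {a : M}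
    (ha : a ∈ Substructure.closure L (Set.range x)) : ∃ t : L.Term α, t.realize x = a := by
  obtain ⟨t, ht⟩ := Substructure.mem_closure_iff_exists_term.1 ha
  refine ⟨t.relabel (fun z => z.2.choose), ?_⟩
  rw [Term.realize_relabel, ← ht]
  congr 1
  funext z
  exact z.2.choose_spec

/-- Tuples with the same atomic type generate isomorphic substructures. -/
theorem SameAtomicType.exists_embedding {x : α → M} {y : α → N} (h : SameAtomicType L x y)
    {S : L.Substructure M} (hS : S ≤ Substructure.closure L (Set.range x)) :
    ∃ g : S ↪[L] N, ∀ (t : L.Term α) (ht : t.realize x ∈ S), g ⟨_, ht⟩ = t.realize y := by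
  -- Each element is sent to the value at `y` of some term naming it; preservation of equalities
  -- makes the choice of term irrelevant.
  choose τ hτ using fun s : S => exists_term_realize_of_mem_closure (hS s.2)
  refine ⟨⟨⟨fun s => (τ s).realize y, fun s s' hs => ?_⟩, fun {n} f xs => ?_,
    fun {n} r xs => ?_⟩, fun t ht => ?_⟩
  · exact Subtype.ext (by rw [← hτ s, ← hτ s']; exact (h.equal _ _).2 hs)
  · have : (τ (funMap f xs)).realize x = (Term.func f fun i => τ (xs i)).realize x := by
      simp only [hτ, Term.realize_func]
      rfl
    exact (h.equal _ _).1 this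
  · refine (h.rel r fun i => τ (xs i)).symm.trans ?_
    simp only [hτ]
    rfl
  · exact (h.equal _ _).1 (hτ ⟨_, ht⟩)

/-- In an ultrahomogeneous structure, tuples with the same atomic type are conjugate. -/
theorem IsUltrahomogeneous.exists_equiv_of_sameAtomicType (hM : L.IsUltrahomogeneous M)
    [Finite α] {x y : α → M} (h : SameAtomicType L x y) : ∃ g : M ≃[L] M, y = g ∘ x := by
  obtain ⟨e, he⟩ := h.exists_embedding le_rfl
  obtain ⟨g, hg⟩ := hM _ (Substructure.fg_closure (Set.finite_range x)) e
  refine ⟨g, funext fun i => ?_⟩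
  have hi : (Term.var i : L.Term α).realize x ∈ Substructure.closure L (Set.range x) :=
    Substructure.subset_closure ⟨i, rfl⟩
  exact (he (Term.var i) hi).symm.trans (DFunLike.congr_fun hg _)

/-- The universal closure of `φ` is a sentence, hence decided by the complete theory. -/
theorem realize_all_iff_of_completeTheory [N ⊨ L.completeTheory M] [Finite α] (φ : L.Formula α) :
    (∀ x : α → N, φ.Realize x) ↔ ∀ x : α → M, φ.Realize x := by
  have := realize_iff_of_model_completeTheory M N
    (Formula.iAlls α (φ.relabel (Sum.inr : α → Empty ⊕ α)))
  simpa [Sentence.Realize, Function.comp_def] using this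

/-- A structure is uniformly locally finite if, for each `n`, finitely many terms in `n` variables
suffice to obtain the values of all terms in `n` variables. -/
def UniformlyLocallyFinite (L : Language.{u, v}) (M : Type*) [L.Structure M] : Prop :=
  ∀ n : ℕ, ∃ F : Finset (L.Term (Fin n)), ∀ t : L.Term (Fin n), ∃ s ∈ F,
    ∀ x : Fin n → M, t.realize x = s.realize x

/-- Through this transfer of identities, a finite set of terms that suffices in `M` suffices in
every model of its theory. -/
theorem realize_term_eq_of_completeTheory [N ⊨ L.completeTheory M] [Finite α] {s t : L.Term α}
    (h : ∀ x : α → M, s.realize x = t.realize x) (x : α → N) : s.realize x = t.realize x := by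
  have := realize_all_iff_of_completeTheory (M := M) (N := N) (s.equal t)
  simp only [Formula.realize_equal] at this
  exact this.2 h x

theorem UniformlyLocallyFinite.finite_of_fg (h : UniformlyLocallyFinite L M)
    {S : L.Substructure M} (hS : S.FG) : Finite S := by
  obtain ⟨n, x, rfl⟩ := Substructure.fg_iff_exists_fin_generating_family.1 hS
  obtain ⟨F, hF⟩ := h n
  refine Set.Finite.subset (F.finite_toSet.image fun t => t.realize x) ?_
  intro a ha
  obtain ⟨t, rfl⟩ := exists_term_realize_of_mem_closure ha
  obtain ⟨s, hs, hst⟩ := hF t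
  exact ⟨s, hs, (hst x).symm⟩

end AtomicType

/-! ### Formulas isolating atomic types -/

section Isolate

variable {L : Language.{u, v}} {α : Type}

/-- Indices for the atomic formulas whose terms belong to `F`. -/
abbrev AtomIndex (F : Finset (L.Term α)) : Type _ :=
  (F × F) ⊕ (Σ R : (Σ k, L.Relations k), Fin R.1 → F)

/-- The atomic formula with a given index. -/
def atom {F : Finset (L.Term α)} : AtomIndex F → L.Formula α
  | .inl p => Term.equal p.1 p.2
  | .inr p => Relations.formula p.1.2 fun i => (p.2 i : L.Term α)

theorem atom_isAtomic {F : Finset (L.Term α)} (p : AtomIndex F) : (atom p).IsAtomic := by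
  rcases p with p | p
  · exact .equal _ _
  · exact .rel _ _

/-- The set of atomic formulas, with terms in `F`, which hold for a tuple. -/
def atomsOf (F : Finset (L.Term α)) {M : Type*} [L.Structure M] (x : α → M) : Set (AtomIndex F) :=
  {p | (atom p).Realize x}

theorem isQF_iInf {α β : Type*} [Finite β] {n : ℕ} {f : β → L.BoundedFormula α n}
    (h : ∀ b, (f b).IsQF) : (BoundedFormula.iInf f).IsQF := by
  let _ := Fintype.ofFinite β
  change (((Finset.univ : Finset β).toList.map f).foldr (· ⊓ ·) ⊤).IsQF
  generalize Finset.toList _ = l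
  induction l with
  | nil => exact .top
  | cons b l ih => exact (h b).inf ih

theorem isQF_iSup {α β : Type*} [Finite β] {n : ℕ} {f : β → L.BoundedFormula α n}
    (h : ∀ b, (f b).IsQF) : (BoundedFormula.iSup f).IsQF := by
  let _ := Fintype.ofFinite β
  change (((Finset.univ : Finset β).toList.map f).foldr (· ⊔ ·) ⊥).IsQF
  generalize Finset.toList _ = l
  induction l with
  | nil => exact .falsum
  | cons b l ih => exact (h b).sup ih

/-- Every term can be replaced by a representative in `F`; the same representative has to serve in
both structures. -/
theorem sameAtomicType_of_atomsOf_eq {F : Finset (L.Term α)} {M : Type*} [L.Structure M]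
    {N : Type*} [L.Structure N]
    (hF : ∀ t : L.Term α, ∃ s ∈ F, (∀ x : α → M, t.realize x = s.realize x) ∧
      ∀ x : α → N, t.realize x = s.realize x)
    {x : α → M} {y : α → N} (h : atomsOf F x = atomsOf F y) : SameAtomicType L x y := by
  choose r hrF hrM hrN using hF
  constructor
  · intro s t
    rw [hrM s, hrM t, hrN s, hrN t]
    simpa [atomsOf, atom] using Set.ext_iff.1 h (.inl (⟨r s, hrF s⟩, ⟨r t, hrF t⟩))
  · intro k R ts
    simp only [fun i => hrM (ts i) x, fun i => hrN (ts i) y]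
    simpa [atomsOf, atom, Formula.realize_rel] using
      Set.ext_iff.1 h (.inr ⟨⟨k, R⟩, fun i => ⟨r (ts i), hrF (ts i)⟩⟩)

variable [Finite (Σ k, L.Relations k)]

open Classical in
/-- The conjunction of the atomic formulas with indices in `τ`, and of the negations of the other
ones. -/
noncomputable def isolate {F : Finset (L.Term α)} (τ : Set (AtomIndex F)) : L.Formula α :=
  Formula.iInf fun p => if p ∈ τ then atom p else (atom p).not

theorem isolate_isQF {F : Finset (L.Term α)} (τ : Set (AtomIndex F)) : (isolate τ).IsQF := by
  refine isQF_iInf fun p => ?_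
  split_ifs
  · exact (atom_isAtomic p).isQF
  · exact (atom_isAtomic p).isQF.not

theorem realize_isolate {F : Finset (L.Term α)} (τ : Set (AtomIndex F)) {M : Type*}
    [L.Structure M] (x : α → M) : (isolate τ).Realize x ↔ atomsOf F x = τ := by
  rw [isolate, Formula.realize_iInf, Set.ext_iff]
  refine forall_congr' fun p => ?_
  split_ifs with hp
  · simp [atomsOf, hp]
  · simp [atomsOf, hp]

end Isolate

end FirstOrder.Language

/-! ### Theories with quantifier elimination -/

namespace FirstOrder.Language

open Structure

variable {L : Language.{u, v}}

/-- `⊨ᵇ` speaks of models in one universe only; going through the universal closure, a sentence,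
reaches models in every universe. -/
theorem Theory.realize_of_models {T : L.Theory} {α : Type} [Finite α] {φ : L.Formula α}
    (h : T ⊨ᵇ φ) (N : Type*) [L.Structure N] [N ⊨ T] [Nonempty N] (x : α → N) : φ.Realize x := by
  have hT : T ⊨ᵇ (Formula.iAlls α (φ.relabel (Sum.inr : α → Empty ⊕ α)) : L.Sentence) := by
    rw [models_sentence_iff]
    intro P
    simp only [Sentence.Realize, Formula.realize_iAlls, Formula.realize_relabel]
    exact models_formula_iff.1 h P
  have := hT.realize_sentence N
  simp only [Sentence.Realize, Formula.realize_iAlls, Formula.realize_relabel] at this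
  exact this x

theorem Theory.HasQuantifierElimination.exists_isQF {T : L.Theory}
    (hT : T.HasQuantifierElimination) {n : ℕ} (φ : L.Formula (Fin n)) :
    ∃ ψ : L.Formula (Fin n), ψ.IsQF ∧ ∀ (N : Type w) [L.Structure N] [N ⊨ T] [Nonempty N]
      (x : Fin n → N), φ.Realize x ↔ ψ.Realize x := by
  obtain ⟨ψ, hψ, h⟩ := hT n φ
  refine ⟨ψ, hψ, fun N _ _ _ x => ?_⟩
  simpa using realize_of_models h N x

/-- The quantifier-free equivalent is the finite disjunction of the isolating formulas of those
atomic types that are realized in `M` by a tuple satisfying `φ`. A tuple with such a type is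
conjugate to one satisfying `φ`. -/
theorem IsUltrahomogeneous.hasQuantifierElimination [Finite (Σ k, L.Relations k)]
    {M : Type*} [L.Structure M] (hM : L.IsUltrahomogeneous M) (hfin : UniformlyLocallyFinite L M) :
    (L.completeTheory M).HasQuantifierElimination := by
  intro n φ
  obtain ⟨F, hF⟩ := hfin n
  let P := {τ : Set (AtomIndex F) // ∃ x : Fin n → M, φ.Realize x ∧ atomsOf F x = τ}
  refine ⟨Formula.iSup fun τ : P => isolate τ.1, isQF_iSup fun τ => isolate_isQF _, ?_⟩
  rw [Theory.models_formula_iff]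
  intro N
  rw [realize_all_iff_of_completeTheory (M := M)]
  intro x
  simp only [Formula.realize_iff, Formula.realize_iSup, realize_isolate]
  constructor
  · exact fun hx => ⟨⟨_, x, hx, rfl⟩, rfl⟩
  · rintro ⟨⟨τ, y, hy, rfl⟩, hxy⟩
    obtain ⟨g, rfl⟩ := hM.exists_equiv_of_sameAtomicType
      (sameAtomicType_of_atomsOf_eq (fun t => by simpa using hF t) hxy.symm)
    exact (StrongHomClass.realize_formula g φ).2 hy

theorem Theory.HasQuantifierElimination.isModelComplete {T : L.Theory}
    (hT : T.HasQuantifierElimination) : IsModelComplete.{u, v, w} T := by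
  intro M N f n φ x
  obtain ⟨ψ, hψ, h⟩ := hT.exists_isQF φ
  rw [h N, h M]
  have := hψ.realize_embedding f (v := x) (xs := default)
  rwa [Subsingleton.elim (f ∘ default) default] at this

/-! ### Diagrams -/

theorem BoundedFormula.IsQF.mapTermRel {L' : Language} {α β : Type*} {g : ℕ → ℕ} {n : ℕ}
    {φ : L.BoundedFormula α n} (hφ : φ.IsQF)
    (ft : ∀ n, L.Term (α ⊕ (Fin n)) → L'.Term (β ⊕ (Fin (g n))))
    (fr : ∀ n, L.Relations n → L'.Relations n)
    (h : ∀ n, L'.BoundedFormula β (g (n + 1)) → L'.BoundedFormula β (g n + 1)) :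
    (φ.mapTermRel ft fr h).IsQF := by
  induction hφ with
  | falsum => exact .falsum
  | of_isAtomic hA =>
    cases hA with
    | equal s t => exact (IsAtomic.equal _ _).isQF
    | rel R ts => exact (IsAtomic.rel _ _).isQF
  | imp _ _ ih₁ ih₂ => exact ih₁.imp ih₂

theorem BoundedFormula.IsQF.equivSentence {α : Type*} {φ : L.Formula α} (hφ : φ.IsQF) :
    (Formula.equivSentence φ).IsQF :=
  (hφ.mapTermRel _ _ _).mapTermRel _ _ _

theorem BoundedFormula.IsQF.equivSentence_symm {α : Type*} {φ : L[[α]].Sentence} (hφ : φ.IsQF) :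
    (Formula.equivSentence.symm φ).IsQF :=
  (hφ.mapTermRel _ _ _).mapTermRel _ _ _

theorem Theory.realize_iff_of_model_diagram {A : Type*} [L.Structure A] {N : Type*}
    [L[[A]].Structure N] [hN : N ⊨ diagram L A] {φ : L[[A]].Sentence} (hφ : φ.IsQF) :
    N ⊨ φ ↔ A ⊨ φ := by
  induction hφ with
  | falsum => exact Iff.rfl
  | @of_isAtomic ψ hA =>
    by_cases hψ : A ⊨ (ψ : L[[A]].Sentence)
    · exact iff_of_true (hN.realize_of_mem _ ⟨hψ, .inl hA⟩) hψ
    · refine iff_of_false ?_ hψ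
      rw [← Sentence.realize_not]
      exact hN.realize_of_mem _ ⟨(Sentence.realize_not A).2 hψ, .inr ⟨_, hA, rfl⟩⟩
  | imp _ _ ih₁ ih₂ => exact imp_congr ih₁ ih₂

theorem Theory.model_diagram_of_embedding {A : Type*} [L.Structure A] {N : Type*}
    [L.Structure N] (e : A ↪[L] N) :
    letI := constantsOn.structure e
    N ⊨ diagram L A := by
  let _ := constantsOn.structure e
  have key : ∀ φ : L[[A]].Sentence, φ.IsQF → (N ⊨ φ ↔ A ⊨ φ) := by
    intro φ hφ
    refine (Formula.realize_equivSentence_symm N φ e).symm.trans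
      (_root_.Iff.trans ?_ (Formula.realize_equivSentence_symm_con A φ))
    have := hφ.equivSentence_symm.realize_embedding e (v := id) (xs := default)
    rw [Subsingleton.elim (e ∘ default) default] at this
    exact this
  refine ⟨fun φ hφ => ?_⟩
  obtain ⟨hφ, hA | ⟨ψ, hA, rfl⟩⟩ := hφ
  · exact (key φ hA.isQF).2 hφ
  · exact (key _ hA.isQF.not).2 hφ

/-- Modulo `T`, a sentence about elements of `A` becomes quantifier-free, and then the diagram
decides it by its truth in `A`. The embedding `e` serves only for satisfiability. -/
theorem Theory.HasQuantifierElimination.isComplete_diagram {T : L.Theory}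
    (hT : T.HasQuantifierElimination) (A : Type w) [L.Structure A] [Nonempty A]
    (N : Type*) [L.Structure N] [N ⊨ T] (e : A ↪[L] N) :
    ((L.lhomWithConstants A).onTheory T ∪ diagram L A).IsComplete := by
  classical
  refine ⟨?_, fun φ => ?_⟩
  · let _ := constantsOn.structure e
    have : Nonempty N := .map e inferInstance
    have hN : N ⊨ (L.lhomWithConstants A).onTheory T ∪ diagram L A :=
      ((LHom.onTheory_model _ _).2 inferInstance).union (model_diagram_of_embedding e)
    exact Model.isSatisfiable N
  · let φ₀ : L.Formula A := Formula.equivSentence.symm φ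
    -- Elimination is stated for variables in `Fin n`, so only the finitely many parameters that
    -- occur are kept.
    let ε := φ₀.freeVarFinset.equivFin
    obtain ⟨ψ, hψ, h⟩ := hT.exists_isQF (φ₀.restrictFreeVar ε : L.Formula _)
    let θ : L[[A]].Sentence :=
      Formula.equivSentence (ψ.relabel (fun i => (ε.symm i : A)) : L.Formula A)
    have hθ : θ.IsQF := BoundedFormula.IsQF.equivSentence (hψ.relabel _)
    have key : ∀ N : ModelType ((L.lhomWithConstants A).onTheory T ∪ diagram L A),
        N ⊨ φ ↔ A ⊨ θ := by
      intro N
      have hd : N ⊨ diagram L A := N.is_model.mono Set.subset_union_right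
      let _ := (L.lhomWithConstants A).reduct N
      have hNT : N ⊨ T := (LHom.onTheory_model (L.lhomWithConstants A) T).1
        (N.is_model.mono Set.subset_union_left)
      rw [← realize_iff_of_model_diagram (N := N) hθ, Formula.realize_equivSentence,
        Formula.realize_relabel, ← Formula.realize_equivSentence_symm_con, ← h]
      refine (BoundedFormula.realize_restrictFreeVar _ ?_).symm
      simp
    by_cases hA : A ⊨ θ
    · exact .inl (models_sentence_iff.2 fun N => (key N).2 hA)
    · refine .inr (models_sentence_iff.2 fun N => ?_)
      exact (Sentence.realize_not N).2 fun hN => hA ((key N).1 hN)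

/-! ### Categoricity -/

section Categorical

variable {M : Type*} [L.Structure M]

/-- To extend `f` to `m`, the existence of a point realizing the type of `m` over the generators `x`
is expressed by a formula. By elimination it is quantifier-free, so it passes from `x` to `f ∘ x₀`.
-/
theorem isExtensionPair_of_completeTheory [Finite (Σ k, L.Relations k)]
    (hQE : (L.completeTheory M).HasQuantifierElimination) (hfin : UniformlyLocallyFinite L M)
    (N N' : Type w) [L.Structure N] [L.Structure N'] [Nonempty N] [Nonempty N']
    [N ⊨ L.completeTheory M] [N' ⊨ L.completeTheory M] : L.IsExtensionPair N N' := by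
  rw [isExtensionPair_iff_exists_embedding_closure_singleton_sup]
  intro S hS f m
  obtain ⟨n, x, rfl⟩ := Substructure.fg_iff_exists_fin_generating_family.1 hS
  let x₀ : Fin n → Substructure.closure L (Set.range x) :=
    fun i => ⟨x i, Substructure.subset_closure ⟨i, rfl⟩⟩
  obtain ⟨F, hF⟩ := hfin (n + 1)
  let χ : L.Formula (Fin (n + 1)) := isolate (atomsOf F (Fin.snoc x m : Fin (n + 1) → N))
  let g : Fin (n + 1) → Fin n ⊕ Unit := Fin.snoc Sum.inl (Sum.inr ())
  obtain ⟨ψ, hψ, h⟩ := hQE.exists_isQF (Formula.iExs Unit (χ.relabel g))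
  have hg : ∀ {P : Type w} (y : Fin n → P) (z : Unit → P),
      Sum.elim y z ∘ g = (Fin.snoc y (z ()) : Fin (n + 1) → P) := by
    intro P y z
    funext i
    refine Fin.lastCases ?_ (fun j => ?_) i <;> simp [g]
  have hψx : ψ.Realize x := by
    rw [← h N, Formula.realize_iExs]
    refine ⟨fun _ => m, ?_⟩
    rw [Formula.realize_relabel, realize_isolate, hg]
  have hψy : ψ.Realize (f ∘ x₀) := by
    have h₁ := hψ.realize_embedding f (v := x₀) (xs := default)
    have h₂ := hψ.realize_embedding (Substructure.subtype _) (v := x₀) (xs := default)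
    rw [Subsingleton.elim (_ ∘ default) default] at h₁ h₂
    exact h₁.2 (h₂.1 hψx)
  rw [← h N', Formula.realize_iExs] at hψy
  obtain ⟨b, hb⟩ := hψy
  rw [Formula.realize_relabel, realize_isolate, hg] at hb
  have hsame : SameAtomicType L (Fin.snoc x m : Fin (n + 1) → N) (Fin.snoc (f ∘ x₀) (b ())) := by
    refine sameAtomicType_of_atomsOf_eq (fun t => ?_) hb.symm
    obtain ⟨s, hs, hst⟩ := hF t
    exact ⟨s, hs, realize_term_eq_of_completeTheory hst, realize_term_eq_of_completeTheory hst⟩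
  have hrange : Set.range (Fin.snoc x m : Fin (n + 1) → N) = {m} ∪ Set.range x := by
    rw [Fin.range_snoc, Set.insert_eq]
  obtain ⟨k, hk⟩ := hsame.exists_embedding
    (S := Substructure.closure L {m} ⊔ Substructure.closure L (Set.range x))
    (by rw [hrange, Substructure.closure_union])
  -- `k` is known on terms in `n + 1` variables; a term in `x` alone is read as such a term that
  -- ignores the last variable.
  refine ⟨k, Embedding.ext ?_⟩
  rintro ⟨s, hs⟩
  obtain ⟨t, rfl⟩ := exists_term_realize_of_mem_closure hs
  have hcs : ∀ {P : Type w} (y : Fin n → P) (p : P),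
      (Fin.snoc y p : Fin (n + 1) → P) ∘ Fin.castSucc = y :=
    fun y p => funext fun i => by simp
  have hN : (t.relabel Fin.castSucc).realize (Fin.snoc x m : Fin (n + 1) → N) = t.realize x := by
    rw [Term.realize_relabel, hcs]
  have hN' : (t.relabel Fin.castSucc).realize (Fin.snoc (f ∘ x₀) (b ()) : Fin (n + 1) → N') =
      t.realize (f ∘ x₀) := by
    rw [Term.realize_relabel, hcs]
  have hx₀ : (⟨t.realize x, hs⟩ : Substructure.closure L (Set.range x)) = t.realize x₀ :=
    Subtype.ext (HomClass.realize_term (Substructure.subtype _) (t := t) (v := x₀))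
  have hle : Substructure.closure L (Set.range x) ≤
      Substructure.closure L {m} ⊔ Substructure.closure L (Set.range x) := le_sup_right
  rw [hx₀, ← HomClass.realize_term f, ← hN', ← hk _ (hN ▸ hle hs),
    Embedding.comp_apply]
  congr 1
  exact Subtype.ext (hN.trans (congrArg Subtype.val hx₀))

/-- The starting point of the back-and-forth: the substructures generated by the empty set are
isomorphic, as the theory decides all atomic sentences. -/
theorem nonempty_fgEquiv_of_completeTheory (N N' : Type*) [L.Structure N] [L.Structure N']
    [N ⊨ L.completeTheory M] [N' ⊨ L.completeTheory M] : Nonempty (L.FGEquiv N N') := by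
  have key : ∀ φ : L.Formula (Fin 0), φ.Realize (default : Fin 0 → N) ↔
      φ.Realize (default : Fin 0 → N') := by
    intro φ
    have h := realize_all_iff_of_completeTheory (M := M) (N := N) φ
    have h' := realize_all_iff_of_completeTheory (M := M) (N := N') φ
    simpa [Unique.forall_iff] using h.trans h'.symm
  have hsame : SameAtomicType L (default : Fin 0 → N) (default : Fin 0 → N') :=
    ⟨fun s t => by simpa using key (s.equal t), fun R ts => by simpa using key (R.formula ts)⟩
  obtain ⟨g, -⟩ := hsame.exists_embedding le_rfl
  exact ⟨⟨⟨_, _, g.equivRange⟩, Substructure.fg_closure (Set.finite_range _)⟩⟩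

theorem isOmegaCategorical_completeTheory [Finite (Σ k, L.Relations k)]
    [Countable (Σ l, L.Functions l)] {M : Type w} [L.Structure M] [Countable M] [Infinite M]
    (hQE : (L.completeTheory M).HasQuantifierElimination) (hfin : UniformlyLocallyFinite L M) :
    Theory.IsOmegaCategorical.{u, v, w} (L.completeTheory M) := by
  refine ⟨⟨Theory.ModelType.of _ M, Cardinal.mk_eq_aleph0 M⟩, fun N N' hN hN' => ?_⟩
  have : Countable N := Cardinal.mk_le_aleph0_iff.1 hN.le
  have : Countable N' := Cardinal.mk_le_aleph0_iff.1 hN'.le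
  obtain ⟨g⟩ := nonempty_fgEquiv_of_completeTheory (L := L) (M := M) N N'
  obtain ⟨f, -⟩ := equiv_between_cg Structure.cg_of_countable Structure.cg_of_countable g
    (isExtensionPair_of_completeTheory hQE hfin N N')
    (isExtensionPair_of_completeTheory hQE hfin N' N)
  exact ⟨f⟩

end Categorical

end FirstOrder.Language

namespace FirstOrder.Language

open Structure

variable {L : Language.{u, v}}

/-! ### Embeddings in ultrapowers -/

/-- If the finitely generated substructures of `A` embed in `M`, then `A` embeds in an ultrapower
of `M`. -/
theorem exists_embedding_model_completeTheory (A M : Type w) [L.Structure A] [L.Structure M]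
    [Nonempty M]
    (h : ∀ S : Finset A, Nonempty (Substructure.closure L (S : Set A) ↪[L] M)) :
    ∃ N : Theory.ModelType.{u, v, w} (L.completeTheory M), Nonempty (A ↪[L] N) := by
  classical
  -- Since `U` refines `atTop`, a given element lies in the substructure generated by `S` for
  -- `U`-almost all `S`; the arbitrary value of `e` elsewhere is never seen.
  let U : Ultrafilter (Finset A) := Ultrafilter.of Filter.atTop
  let e : A → Finset A → M := fun a S =>
    if ha : a ∈ Substructure.closure L (S : Set A) then (h S).some ⟨a, ha⟩ else Classical.arbitrary M
  have he : ∀ (S : Finset A) (a : A) (ha : a ∈ Substructure.closure L (S : Set A)),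
      e a S = (h S).some ⟨a, ha⟩ := fun S a ha => dif_pos ha
  have hmem : ∀ a : A, ∀ᶠ S : Finset A in (U : Filter (Finset A)),
      a ∈ Substructure.closure L (S : Set A) := by
    intro a
    refine Filter.Eventually.filter_mono (Ultrafilter.of_le _) ?_
    refine (Filter.eventually_ge_atTop {a}).mono fun S hS => Substructure.subset_closure ?_
    exact hS (Finset.mem_singleton_self a)
  have hmems : ∀ {n : ℕ} (x : Fin n → A), ∀ᶠ S : Finset A in (U : Filter (Finset A)),
      ∀ i, x i ∈ Substructure.closure L (S : Set A) :=
    fun x => Filter.eventually_all.2 fun i => hmem (x i)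
  let N := (U : Filter (Finset A)).Product fun _ => M
  have hN : N ⊨ L.completeTheory M := by
    refine ⟨fun φ hφ => ?_⟩
    rw [Ultraproduct.sentence_realize]
    exact Filter.Eventually.of_forall fun _ => hφ
  refine ⟨Theory.ModelType.of _ N, ⟨⟨⟨fun a => (e a : N), fun a b hab => ?_⟩,
    fun {n} f x => ?_, fun {n} r x => ?_⟩⟩⟩
  · have hab' : ∀ᶠ S : Finset A in (U : Filter (Finset A)), e a S = e b S := Quotient.eq''.1 hab
    obtain ⟨S, ⟨hS, ha⟩, hb⟩ := ((hab'.and (hmem a)).and (hmem b)).exists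
    rw [he S a ha, he S b hb] at hS
    exact congrArg Subtype.val ((h S).some.injective hS)
  · refine (Quotient.sound ?_ : (e (funMap f x) : N) =
      (fun S => funMap f fun i => e (x i) S : N)).trans (Ultraproduct.funMap_cast f _).symm
    refine (hmems x).mono fun S hS => ?_
    change e (funMap f x) S = funMap f fun i => e (x i) S
    have hf : funMap f x ∈ Substructure.closure L (S : Set A) :=
      (Substructure.closure L (S : Set A)).fun_mem f x hS
    rw [he S _ hf]
    simp only [fun i => he S (x i) (hS i)]
    exact (h S).some.map_fun f fun i => ⟨x i, hS i⟩
  · have : RelMap r (fun i => (e (x i) : N)) ↔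
        ∀ᶠ S : Finset A in (U : Filter (Finset A)), RelMap r fun i => e (x i) S :=
      relMap_quotient_mk' (s := (U : Filter (Finset A)).productSetoid fun _ => M) r
        (fun i => e (x i))
    refine this.trans ?_
    have hS : ∀ᶠ S : Finset A in (U : Filter (Finset A)), (RelMap r fun i => e (x i) S) ↔ RelMap r x := by
      refine (hmems x).mono fun S hS => ?_
      simp only [fun i => he S (x i) (hS i)]
      exact (h S).some.map_rel r fun i => ⟨x i, hS i⟩
    rw [Filter.eventually_congr hS, Filter.eventually_const]

/-! ### Universal theories -/

/-- The hypothesis ranges over all finitely generated substructures containing the tuple, because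
each universal quantifier adds an element and so enlarges the substructure. -/
theorem BoundedFormula.IsUniversal.realize_of_fg {M : Type*} [L.Structure M] {n : ℕ}
    {φ : L.BoundedFormula Empty n} (hφ : φ.IsUniversal) (x : Fin n → M)
    (h : ∀ (S : L.Substructure M), S.FG → ∀ y : Fin n → S, (fun i => (y i : M)) = x →
      φ.Realize default y) : φ.Realize default x := by
  induction hφ with
  | of_isQF hQF =>
    let S := Substructure.closure L (Set.range x)
    let y : Fin _ → S := fun i => ⟨x i, Substructure.subset_closure ⟨i, rfl⟩⟩
    have := (hQF.realize_embedding S.subtype (v := default) (xs := y)).2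
      (h S (Substructure.fg_closure (Set.finite_range x)) y rfl)
    rwa [Subsingleton.elim (_ ∘ default) default] at this
  | all _ ih =>
    rw [realize_all]
    intro a
    refine ih _ fun S hS y hy => ?_
    have := h S hS (fun i => y i.castSucc)
      (funext fun i => by simpa using congrFun hy i.castSucc)
    rw [realize_all] at this
    convert! this (y (Fin.last _))
    exact (Fin.snoc_init_self y).symm

theorem Theory.model_of_fg {T : L.Theory} [hT : T.IsUniversal] (M : Type*) [L.Structure M]
    (h : ∀ S : L.Substructure M, S.FG → S ⊨ T) : M ⊨ T := by
  refine ⟨fun φ hφ => ?_⟩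
  refine (hT.isUniversal_of_mem hφ).realize_of_fg default fun S hS y _ => ?_
  have := (h S hS).realize_of_mem φ hφ
  rwa [Subsingleton.elim y default]

/-! ### Existence of Fraïssé limits -/

section Fraisse

variable {K : Set (Bundled.{w} L.Structure)}

/-- All embeddings in `N` of substructures of `B` can be extended to `B`, simultaneously, in an
extension of `N`. -/
theorem IsFraisse.exists_extension [hK : IsFraisse K] (hfin : ∀ N ∈ K, Finite N)
    (N : Bundled.{w} L.Structure) (hN : N ∈ K) (B : Bundled.{w} L.Structure) (hB : B ∈ K) :
    ∃ N' ∈ K, ∃ j : N ↪[L] N', Nonempty (B ↪[L] N') ∧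
      ∀ (S : L.Substructure B) (e : S ↪[L] N), ∃ e' : B ↪[L] N', ∀ s : S, e' s = j (e s) := by
  classical
  have := hfin N hN
  have := hfin B hB
  have : ∀ S : L.Substructure B, Finite (S ↪[L] N) := fun S =>
    Finite.of_injective (fun e => (e : S → N)) DFunLike.coe_injective
  have : Finite (L.Substructure B) :=
    Finite.of_injective (fun S => (S : Set B)) SetLike.coe_injective
  have : Fintype (Σ S : L.Substructure B, S ↪[L] N) := Fintype.ofFinite _
  -- There are finitely many partial embeddings; they are handled one at a time, each by an
  -- amalgamation that carries along the extensions already found.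
  have key : ∀ s : Finset (Σ S : L.Substructure B, S ↪[L] N),
      ∃ N' ∈ K, ∃ j : N ↪[L] N', Nonempty (B ↪[L] N') ∧
        ∀ p ∈ s, ∃ e' : B ↪[L] N', ∀ x : p.1, e' x = j (p.2 x) := by
    intro s
    induction s using Finset.induction_on with
    | empty =>
      obtain ⟨N', hN', ⟨j⟩, hj⟩ := hK.jointEmbedding N hN B hB
      exact ⟨N', hN', j, hj, by simp⟩
    | insert p s _ ih =>
      obtain ⟨N', hN', j, ⟨k⟩, h⟩ := ih
      have hS : Bundled.mk p.1 ∈ K := hK.hereditary B hB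
        ⟨Structure.FG.of_finite, ⟨p.1.subtype⟩⟩
      obtain ⟨Q, f, g, hQ, hfg⟩ := hK.amalgamation (Bundled.mk p.1) N' B (j.comp p.2) p.1.subtype
        hS hN' hB
      refine ⟨Q, hQ, f.comp j, ⟨g⟩, fun q hq => ?_⟩
      rcases Finset.mem_insert.1 hq with rfl | hq
      · exact ⟨g, fun x => (DFunLike.congr_fun hfg x).symm⟩
      · obtain ⟨e', he'⟩ := h q hq
        exact ⟨f.comp e', fun x => congrArg f (he' x)⟩
  obtain ⟨N', hN', j, hj, h⟩ := key Finset.univ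
  exact ⟨N', hN', j, hj, fun S e => h ⟨S, e⟩ (Finset.mem_univ _)⟩

/-- An embedding of a finitely generated structure in a direct limit factors through one of the
components. -/
theorem DirectLimit.exists_factor {ι : Type*} [Preorder ι] [IsDirectedOrder ι] [Nonempty ι]
    (G : ι → Type w) [∀ i, L.Structure (G i)] (f : ∀ i j, i ≤ j → G i ↪[L] G j)
    [DirectedSystem G fun i j h => f i j h] {A : Type*} [L.Structure A] (hA : Structure.FG L A)
    (e : A ↪[L] DirectLimit G f) :
    ∃ (i : ι) (e₀ : A ↪[L] G i), ∀ a, DirectLimit.of L ι G f i (e₀ a) = e a := by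
  obtain ⟨i, S, hS⟩ := DirectLimit.exists_fg_substructure_in_Sigma e.toHom.range (hA.range _)
  have hle : e.toHom.range ≤ (DirectLimit.of L ι G f i).toHom.range := by
    rw [← hS, Hom.range_eq_map]
    exact Substructure.monotone_map le_top
  let o := (DirectLimit.of L ι G f i).equivRange
  refine ⟨i, o.symm.toEmbedding.comp ((Substructure.inclusion hle).comp e.equivRange.toEmbedding),
    fun a => ?_⟩
  have := congrArg Subtype.val
    (o.apply_symm_apply (Substructure.inclusion hle (e.equivRange a)))
  exact this

/-- Adjoining `m` to `S` is the inclusion of `S` in a finitely generated substructure of `M`, which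
is a member of `K`. -/
theorem isExtensionPair_of_extension {M N : Type w} [L.Structure M] [L.Structure N]
    (hage : L.age M ⊆ K)
    (h : ∀ B ∈ K, ∀ (A : Bundled.{w} L.Structure), Structure.FG L A → ∀ (i : A ↪[L] B)
      (e : A ↪[L] N), ∃ e' : B ↪[L] N, ∀ a, e' (i a) = e a) : L.IsExtensionPair M N := by
  rw [isExtensionPair_iff_exists_embedding_closure_singleton_sup]
  intro S hS f m
  have hB := hage (age.fg_substructure ((Substructure.fg_closure_singleton m).sup hS))
  obtain ⟨g, hg⟩ := h _ hB (Bundled.mk S) (S.fg_iff_structure_fg.1 hS)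
    (Substructure.inclusion le_sup_right) f
  exact ⟨g, Embedding.ext fun a => (hg a).symm⟩

/-- A Fraïssé class of finite structures has a Fraïssé limit. -/
theorem IsFraisse.exists_isFraisseLimit [Countable (Σ l, L.Functions l)] [hK : IsFraisse K]
    (hfin : ∀ N ∈ K, Finite N) :
    ∃ (M : Type w) (_ : L.Structure M) (_ : Countable M), IsFraisseLimit K M := by
  obtain ⟨F, hF⟩ := hK.is_essentially_countable.exists_eq_range (hK.is_nonempty.image _)
  have hFK : ∀ n, ∃ B ∈ K, Quotient.mk' B = F n := fun n =>
    (hF ▸ Set.mem_range_self n : F n ∈ Quotient.mk' '' K)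
  choose B hBK hBF using hFK
  have hB : ∀ N ∈ K, ∃ n, Nonempty (N ≃[L] B n) := by
    intro N hN
    obtain ⟨n, hn⟩ : Quotient.mk' N ∈ Set.range F := hF ▸ Set.mem_image_of_mem _ hN
    exact ⟨n, Quotient.exact (hn.symm.trans (hBF n).symm)⟩
  choose P hPK j hBP hP using fun (N : K) (n : ℕ) =>
    hK.exists_extension hfin N.1 N.2 (B n.unpair.1) (hBK _)
  let G : ℕ → K := Nat.rec ⟨B 0, hBK 0⟩ fun n N => ⟨P N n, hPK N n⟩
  let f₁ : ∀ n, (G n).1 ↪[L] (G (n + 1)).1 := fun n => j (G n) n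
  let f : ∀ i k : ℕ, i ≤ k → (G i).1 ↪[L] (G k).1 := DirectedSystem.natLERec f₁
  let M := DirectLimit (fun n => (G n).1) f
  let o : ∀ n, (G n).1 ↪[L] M := DirectLimit.of L ℕ (fun n => (G n).1) f
  have hof : ∀ (i k : ℕ) (hik : i ≤ k) (x : (G i).1), o k (f i k hik x) = o i x :=
    fun i k hik x => DirectLimit.of_f
  have hcg : Structure.CG L M := DirectLimit.cg _ fun n => (hK.FG _ (G n).2).cg
  have hcount : Countable M := Structure.cg_iff_countable.1 hcg
  -- Stage `n` treats the type numbered `n.unpair.1`. As `Nat.pair m n₀ ≥ n₀`, each type recurs at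
  -- arbitrarily late stages, after any given partial embedding has appeared.
  have hstage : ∀ N ∈ K, ∀ n₀ : ℕ, ∃ n, n₀ ≤ n ∧ Nonempty (N ≃[L] B n.unpair.1) := by
    intro N hN n₀
    obtain ⟨m, hm⟩ := hB N hN
    exact ⟨Nat.pair m n₀, Nat.right_le_pair m n₀, by rwa [Nat.unpair_pair]⟩
  have hage : L.age M = K := by
    refine subset_antisymm ?_ fun N hN => ?_
    · rintro N ⟨hN, ⟨e⟩⟩
      obtain ⟨n, e₀, -⟩ := DirectLimit.exists_factor _ _ hN e
      exact hK.hereditary _ (G n).2 ⟨hN, ⟨e₀⟩⟩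
    · obtain ⟨n, -, ⟨ε⟩⟩ := hstage N hN 0
      exact ⟨hK.FG N hN, ⟨(o (n + 1)).comp ((hBP (G n) n).some.comp ε.toEmbedding)⟩⟩
  refine ⟨M, inferInstance, hcount, ⟨?_, hage⟩⟩
  rw [isUltrahomogeneous_iff_IsExtensionPair hcg]
  refine isExtensionPair_of_extension hage.subset fun N hN A hA i e => ?_
  obtain ⟨n₀, e₀, he₀⟩ := DirectLimit.exists_factor _ _ hA e
  obtain ⟨n, hn, ⟨ε⟩⟩ := hstage N hN n₀
  -- The stage extends embeddings of substructures of `B _`, so `A` is replaced by its image there.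
  let i' := ε.toEmbedding.comp i
  obtain ⟨e', he'⟩ := hP (G n) n i'.toHom.range
    ((f n₀ n hn).comp (e₀.comp i'.equivRange.symm.toEmbedding))
  refine ⟨(o (n + 1)).comp (e'.comp ε.toEmbedding), fun a => ?_⟩
  have h₁ := he' (i'.equivRange a)
  rw [← he₀, ← hof n₀ n hn, ← hof n (n + 1) n.le_succ]
  have h₂ : f n (n + 1) n.le_succ = f₁ n := by
    ext x
    simp [f, Nat.leRecOn_succ']
  rw [h₂]
  change o (n + 1) (e' (i'.equivRange a)) = _
  rw [h₁]
  simp [f₁]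

end Fraisse

end FirstOrder.Language

namespace FirstOrder.Language

open Structure

variable {L : Language.{u, v}}

/-! ### Finite models of universal theories -/

theorem finite_structure [Finite (Σ l, L.Functions l)] [Finite (Σ k, L.Relations k)]
    (X : Type*) [Finite X] : Finite (L.Structure X) := by
  refine Finite.of_injective
    (β := (∀ f : Σ l, L.Functions l, (Fin f.1 → X) → X) ×
      (∀ r : Σ k, L.Relations k, (Fin r.1 → X) → Prop))
    (fun S => (fun f => S.funMap f.2, fun r => S.RelMap r.2)) fun S S' h => ?_
  rw [Prod.mk.injEq] at h
  ext n f x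
  · exact congrFun (congrFun h.1 ⟨n, f⟩) x
  · exact (congrFun (congrFun h.2 ⟨n, f⟩) x).to_iff

/-- Up to isomorphism the carrier is `Fin k`, and each `Fin k` carries finitely many structures. -/
theorem countable_quotient_of_finite [Finite (Σ l, L.Functions l)] [Finite (Σ k, L.Relations k)]
    (K : Set (Bundled.{w} L.Structure)) (hfin : ∀ N ∈ K, Finite N) :
    (Quotient.mk' '' K).Countable := by
  have := fun k => finite_structure (L := L) (ULift.{w} (Fin k))
  refine (Set.countable_range fun p : Σ k, L.Structure (ULift.{w} (Fin k)) =>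
    (Quotient.mk' (Bundled.mk _ p.2) : Quotient (equivSetoid (L := L)))).mono ?_
  rintro _ ⟨N, hN, rfl⟩
  have := hfin N hN
  let e : N ≃ ULift.{w} (Fin (Nat.card N)) := (Finite.equivFin N).trans Equiv.ulift.symm
  exact ⟨⟨_, e.inducedStructure⟩, Quotient.sound ⟨(Equiv.bundledInducedEquiv L e).symm⟩⟩

variable {T : L.Theory}

theorem isFraisse_finiteModels [T.IsUniversal] [Finite (Σ l, L.Functions l)]
    [Finite (Σ k, L.Relations k)]
    (hulf : ∀ (N : Type w) [L.Structure N], N ⊨ T → UniformlyLocallyFinite L N)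
    {le : ∀ (M : Type w) [L.Structure M], M → M → Prop}
    (hamal : Superamalgamation.{u, v, w} T le)
    (C₀ : Bundled.{w} L.Structure) (hC₀ : C₀ ∈ finiteModels T)
    (hinit : ∀ N : Bundled.{w} L.Structure, N ⊨ T → Nonempty (C₀ ↪[L] N)) :
    IsFraisse (finiteModels.{u, v, w} T) := by
  have hamal' : Amalgamation (finiteModels.{u, v, w} T) := by
    rintro C A B f g ⟨-, hC⟩ ⟨_, hA⟩ ⟨_, hB⟩
    obtain ⟨D, h, k, hD, hfg, -⟩ := hamal A B C hA hB hC f g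
    -- The amalgam `D` may be infinite; the substructure generated by the two images is finite and
    -- still a model, `T` being universal.
    let S := h.toHom.range ⊔ k.toHom.range
    have hS : S.FG := ((Structure.FG.of_finite).range h.toHom).sup
      ((Structure.FG.of_finite).range k.toHom)
    refine ⟨Bundled.mk S,
      h.codRestrict S fun a => (le_sup_left : h.toHom.range ≤ S) ⟨a, rfl⟩,
      k.codRestrict S fun b => (le_sup_right : k.toHom.range ≤ S) ⟨b, rfl⟩,
      ⟨(hulf D hD).finite_of_fg hS, inferInstance⟩, ?_⟩
    refine Embedding.ext fun c => Subtype.ext ?_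
    exact hfg c
  refine ⟨⟨C₀, hC₀⟩, ?_, countable_quotient_of_finite _ fun N hN => hN.1, ?_, ?_, hamal'⟩
  · rintro N ⟨_, -⟩
    exact Structure.FG.of_finite
  · rintro N ⟨_, hN⟩ A ⟨-, ⟨e⟩⟩
    exact ⟨Finite.of_injective e e.injective, Theory.IsUniversal.models_of_embedding e⟩
  · intro A hA B hB
    obtain ⟨f⟩ := hinit A hA.2
    obtain ⟨g⟩ := hinit B hB.2
    obtain ⟨D, h, k, hD, -⟩ := hamal' C₀ A B f g hC₀ hA hB
    exact ⟨D, hD, ⟨h⟩, ⟨k⟩⟩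

/-- A universal theory in a finite language, with uniformly locally finite models, with the
superamalgamation property, with an initial finite model and with arbitrarily large finite models,
has a Fraïssé limit of its finite models, whose theory is the model completion of the given
theory. -/
theorem exists_isFraisseLimit_isModelCompletion [hT : T.IsUniversal]
    [Finite (Σ l, L.Functions l)] [Finite (Σ k, L.Relations k)]
    (hulf : ∀ (N : Type w) [L.Structure N], N ⊨ T → UniformlyLocallyFinite L N)
    {le : ∀ (M : Type w) [L.Structure M], M → M → Prop}
    (hamal : Superamalgamation.{u, v, w} T le)
    (C₀ : Bundled.{w} L.Structure) (hC₀ : C₀ ∈ finiteModels T)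
    (hinit : ∀ N : Bundled.{w} L.Structure, N ⊨ T → Nonempty (C₀ ↪[L] N))
    (hlarge : ∀ n : ℕ, ∃ B ∈ finiteModels.{u, v, w} T, n < Nat.card B) :
    ∃ (M : Type w) (_ : L.Structure M) (_ : Countable M),
      IsFraisseLimit (finiteModels.{u, v, w} T) M ∧
      Theory.IsOmegaCategorical.{u, v, w} (L.completeTheory M) ∧
      Theory.HasQuantifierElimination (L.completeTheory M) ∧
      Theory.IsModelCompletion.{u, v, w} (L.completeTheory M) T := by
  have := isFraisse_finiteModels hulf hamal C₀ hC₀ hinit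
  obtain ⟨M, _, _, hM⟩ := IsFraisse.exists_isFraisseLimit (K := finiteModels.{u, v, w} T)
    fun N hN => hN.1
  have hMT : M ⊨ T := Theory.model_of_fg M fun S hS =>
    (hM.age.subset (age.fg_substructure hS)).2
  have hemb : ∀ B ∈ finiteModels.{u, v, w} T, Nonempty (B ↪[L] M) :=
    fun B hB => (hM.age.superset hB).2
  have : Infinite M := by
    refine not_finite_iff_infinite.1 fun _ => ?_
    obtain ⟨B, hB, hcard⟩ := hlarge (Nat.card M)
    obtain ⟨e⟩ := hemb B hB
    exact hcard.not_ge (Nat.card_le_card_of_injective e e.injective)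
  have hQE := hM.ultrahomogeneous.hasQuantifierElimination (hulf M hMT)
  have hext : ∀ A : Theory.ModelType.{u, v, w} T,
      ∃ N : Theory.ModelType.{u, v, w} (L.completeTheory M), Nonempty (A ↪[L] N) := by
    intro A
    refine exists_embedding_model_completeTheory A M fun S => ?_
    exact hemb (Bundled.mk (Substructure.closure L (S : Set A)))
      ⟨(hulf A A.is_model).finite_of_fg (Substructure.fg_closure S.finite_toSet), inferInstance⟩
  refine ⟨M, _, _, hM, isOmegaCategorical_completeTheory hQE (hulf M hMT), hQE,
    ⟨fun φ hφ => ?_, hQE.isModelComplete, hext, fun A => ?_⟩⟩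
  · exact Theory.models_sentence_of_mem (hMT.realize_of_mem φ hφ)
  · obtain ⟨N, ⟨e⟩⟩ := hext A
    exact hQE.isComplete_diagram A N e

end FirstOrder.Language

/-! ### Amalgamation of contact orders -/

/-- The axioms of contact posets, for an order `le`, a relation `con` and a minimum `z`. -/
structure IsContactOrder {A : Type*} (le con : A → A → Prop) (z : A) : Prop where
  refl : ∀ a, le a a
  trans : ∀ a b c, le a b → le b c → le a c
  antisymm : ∀ a b, le a b → le b a → a = b
  bot : ∀ a, le z a
  symm : ∀ a b, con a b → con b a
  ne_bot : ∀ a b, con a b → z ≠ a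
  ext : ∀ a b a₁ b₁, con a b → le a a₁ → le b b₁ → con a₁ b₁
  contact_self : ∀ a, a ≠ z → con a a

/-- Two contact orders with a common suborder. -/
structure ContactSpan (A B C : Type*) where
  /-- the order of `A` -/
  leA : A → A → Prop
  /-- the contact relation of `A` -/
  conA : A → A → Prop
  /-- the minimum of `A` -/
  zA : A
  /-- the order of `B` -/
  leB : B → B → Prop
  /-- the contact relation of `B` -/
  conB : B → B → Prop
  /-- the minimum of `B` -/
  zB : B
  /-- the order of `C` -/
  leC : C → C → Prop
  /-- the contact relation of `C` -/
  conC : C → C → Prop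
  /-- the minimum of `C` -/
  zC : C
  /-- the embedding in `A` -/
  f : C → A
  /-- the embedding in `B` -/
  g : C → B
  hA : IsContactOrder leA conA zA
  hB : IsContactOrder leB conB zB
  f_bot : f zC = zA
  g_bot : g zC = zB
  f_le : ∀ c c', leA (f c) (f c') ↔ leC c c'
  g_le : ∀ c c', leB (g c) (g c') ↔ leC c c'
  f_con : ∀ c c', conA (f c) (f c') ↔ conC c c'
  g_con : ∀ c c', conB (g c) (g c') ↔ conC c c'

namespace ContactSpan

variable {A B C : Type*} (S : ContactSpan A B C)

/-- The span with `A` and `B` exchanged. -/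
def swap : ContactSpan B A C :=
  ⟨S.leB, S.conB, S.zB, S.leA, S.conA, S.zA, S.leC, S.conC, S.zC, S.g, S.f, S.hB, S.hA, S.g_bot,
    S.f_bot, S.g_le, S.f_le, S.g_con, S.f_con⟩

/-- Pairs of lower sets, of `A` and of `B`, with the same trace on `C`. -/
structure Compatible (X : Set A × Set B) : Prop where
  lowerA : ∀ a a', S.leA a a' → a' ∈ X.1 → a ∈ X.1
  lowerB : ∀ b b', S.leB b b' → b' ∈ X.2 → b ∈ X.2
  botA : S.zA ∈ X.1
  botB : S.zB ∈ X.2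
  trace : ∀ c, S.f c ∈ X.1 ↔ S.g c ∈ X.2

theorem Compatible.swap {S : ContactSpan A B C} {X : Set A × Set B} (h : S.Compatible X) :
    S.swap.Compatible X.swap :=
  ⟨h.lowerB, h.lowerA, h.botB, h.botA, fun c => (h.trace c).symm⟩

/-- The smallest compatible pair containing an element of `A`. -/
def inl (a : A) : Set A × Set B :=
  ({a' | S.leA a' a}, {b | ∃ c, S.leB b (S.g c) ∧ S.leA (S.f c) a})

/-- The smallest compatible pair containing an element of `B`. -/
def inr (b : B) : Set A × Set B := (S.swap.inl b).swap

/-- The contact relation between compatible pairs. -/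
def Contact (X Y : Set A × Set B) : Prop :=
  (∃ a ∈ X.1, ∃ a' ∈ Y.1, S.conA a a') ∨ ∃ b ∈ X.2, ∃ b' ∈ Y.2, S.conB b b'

/-- The traces agree because both embeddings reflect the order of `C`: `g c ≤ g c'` with `f c' ≤ a`
gives `f c ≤ f c' ≤ a`. -/
theorem compatible_inl (a : A) : S.Compatible (S.inl a) where
  lowerA _ _ h h' := S.hA.trans _ _ _ h h'
  lowerB _ _ h := fun ⟨c, hc, hca⟩ => ⟨c, S.hB.trans _ _ _ h hc, hca⟩
  botA := S.hA.bot a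
  botB := ⟨S.zC, S.hB.bot _, by rw [S.f_bot]; exact S.hA.bot a⟩
  trace c := by
    refine ⟨fun h => ⟨c, S.hB.refl _, h⟩, ?_⟩
    rintro ⟨c', h, h'⟩
    exact S.hA.trans _ _ _ ((S.f_le c c').2 ((S.g_le c c').1 h)) h'

theorem compatible_inr (b : B) : S.Compatible (S.inr b) := (S.swap.compatible_inl b).swap

variable {S}

/-- This is the universal property of the least pair; the order facts below are instances of it. -/
theorem Compatible.inl_le_iff {X : Set A × Set B} (hX : S.Compatible X) {a : A} :
    S.inl a ≤ X ↔ a ∈ X.1 := by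
  refine ⟨fun h => h.1 (S.hA.refl a), fun h => ⟨fun a' ha' => hX.lowerA _ _ ha' h, ?_⟩⟩
  rintro b ⟨c, hbc, hca⟩
  exact hX.lowerB _ _ hbc ((hX.trace c).1 (hX.lowerA _ _ hca h))

theorem Compatible.inr_le_iff {X : Set A × Set B} (hX : S.Compatible X) {b : B} :
    S.inr b ≤ X ↔ b ∈ X.2 :=
  and_comm.trans hX.swap.inl_le_iff

variable (S)

theorem inl_le_inl {a a' : A} : S.inl a ≤ S.inl a' ↔ S.leA a a' :=
  (S.compatible_inl a').inl_le_iff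

theorem inr_le_inr {b b' : B} : S.inr b ≤ S.inr b' ↔ S.leB b b' :=
  (S.compatible_inr b').inr_le_iff

theorem inl_le_inr {a : A} {b : B} :
    S.inl a ≤ S.inr b ↔ ∃ c, S.leA a (S.f c) ∧ S.leB (S.g c) b :=
  (S.compatible_inr b).inl_le_iff

theorem inr_le_inl {a : A} {b : B} :
    S.inr b ≤ S.inl a ↔ ∃ c, S.leB b (S.g c) ∧ S.leA (S.f c) a :=
  (S.compatible_inl a).inr_le_iff

theorem inl_injective : Function.Injective S.inl := fun _ _ h =>
  S.hA.antisymm _ _ (S.inl_le_inl.1 h.le) (S.inl_le_inl.1 h.ge)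

theorem inr_injective : Function.Injective S.inr := fun _ _ h =>
  S.hB.antisymm _ _ (S.inr_le_inr.1 h.le) (S.inr_le_inr.1 h.ge)

theorem inl_f (c : C) : S.inl (S.f c) = S.inr (S.g c) :=
  le_antisymm (S.inl_le_inr.2 ⟨c, S.hA.refl _, S.hB.refl _⟩)
    (S.inr_le_inl.2 ⟨c, S.hB.refl _, S.hA.refl _⟩)

theorem inl_bot : S.inl S.zA = S.inr S.zB := by
  rw [← S.f_bot, ← S.g_bot, S.inl_f]

theorem exists_of_inl_eq_inr {a : A} {b : B} (h : S.inl a = S.inr b) :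
    ∃ c, S.f c = a ∧ S.g c = b := by
  obtain ⟨c, hac, hcb⟩ := S.inl_le_inr.1 h.le
  obtain ⟨c', hbc', hca'⟩ := S.inr_le_inl.1 h.ge
  -- The two interpolants coincide: `f c' ≤ a ≤ f c` gives one inequality and `g c ≤ b ≤ g c'` the
  -- other.
  have hc'c : S.leC c' c := (S.f_le _ _).1 (S.hA.trans _ _ _ hca' hac)
  have hcc' : S.leC c c' := (S.g_le _ _).1 (S.hB.trans _ _ _ hcb hbc')
  exact ⟨c, S.hA.antisymm _ _ (S.hA.trans _ _ _ ((S.f_le _ _).2 hcc') hca') hac,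
    S.hB.antisymm _ _ hcb (S.hB.trans _ _ _ hbc' ((S.g_le _ _).2 hc'c))⟩

/-- A contact in the `B`-parts lies below some `g c`, `g c'`; (Ext) puts these in contact, hence
also `f c` and `f c'`, which lie below `a` and `a'`. -/
theorem contact_inl {a a' : A} : S.Contact (S.inl a) (S.inl a') ↔ S.conA a a' := by
  refine ⟨?_, fun h => .inl ⟨a, S.hA.refl a, a', S.hA.refl a', h⟩⟩
  rintro (⟨u, hu, v, hv, huv⟩ | ⟨u, ⟨c, huc, hca⟩, v, ⟨c', hvc', hca'⟩, huv⟩)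
  · exact S.hA.ext _ _ _ _ huv hu hv
  · have hcc' : S.conB (S.g c) (S.g c') := S.hB.ext _ _ _ _ huv huc hvc'
    rw [S.g_con, ← S.f_con] at hcc'
    exact S.hA.ext _ _ _ _ hcc' hca hca'

theorem contact_inr {b b' : B} : S.Contact (S.inr b) (S.inr b') ↔ S.conB b b' :=
  or_comm.trans S.swap.contact_inl

/-- The predicate `p` allows both uses: all compatible pairs for posets, pairs of ideals for
semilattices. For (Ref), a pair other than the minimum has a nonzero element in one of its parts. -/
theorem isContactOrder {p : Set A × Set B → Prop} (hp : ∀ X, p X → S.Compatible X)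
    (h₀ : p (S.inl S.zA)) :
    IsContactOrder (fun X Y : {X // p X} => X.1 ≤ Y.1) (fun X Y => S.Contact X.1 Y.1)
      ⟨S.inl S.zA, h₀⟩ where
  refl X := le_refl X.1
  trans X Y Z h h' := le_trans (a := X.1) h h'
  antisymm X Y h h' := Subtype.ext (le_antisymm h h')
  bot X := (hp _ X.2).inl_le_iff.2 (hp _ X.2).botA
  symm X Y := by
    rintro (⟨u, hu, v, hv, h⟩ | ⟨u, hu, v, hv, h⟩)
    · exact .inl ⟨v, hv, u, hu, S.hA.symm _ _ h⟩
    · exact .inr ⟨v, hv, u, hu, S.hB.symm _ _ h⟩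
  ne_bot X Y := by
    rintro (⟨u, hu, v, hv, h⟩ | ⟨u, hu, v, hv, h⟩) hX
    · rw [← hX] at hu
      exact S.hA.ne_bot _ _ h (S.hA.antisymm _ _ (S.hA.bot u) hu)
    · have hu : u ∈ (S.inl S.zA).2 := by rwa [← hX] at hu
      rw [S.inl_bot] at hu
      exact S.hB.ne_bot _ _ h (S.hB.antisymm _ _ (S.hB.bot u) hu)
  ext X Y X₁ Y₁ := by
    rintro (⟨u, hu, v, hv, h⟩ | ⟨u, hu, v, hv, h⟩) hX hY
    · exact .inl ⟨u, hX.1 hu, v, hY.1 hv, h⟩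
    · exact .inr ⟨u, hX.2 hu, v, hY.2 hv, h⟩
  contact_self X hX := by
    by_contra hcon
    have hXA : X.1.1 ⊆ (S.inl S.zA).1 := by
      intro u hu
      have : u = S.zA := by
        by_contra hne
        exact hcon (.inl ⟨u, hu, u, hu, S.hA.contact_self u hne⟩)
      exact this ▸ S.hA.refl _
    have hXB : X.1.2 ⊆ (S.inl S.zA).2 := by
      intro u hu
      have : u = S.zB := by
        by_contra hne
        exact hcon (.inr ⟨u, hu, u, hu, S.hB.contact_self u hne⟩)
      exact this ▸ (S.compatible_inl _).botB
    refine hX (Subtype.ext (le_antisymm (Prod.mk_le_mk.2 ⟨hXA, hXB⟩) ?_))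
    exact (hp _ X.2).inl_le_iff.2 (hp _ X.2).botA

end ContactSpan

theorem eq_vecCons {P : Type*} (y : Fin 2 → P) : y = ![y 0, y 1] := by
  funext i
  fin_cases i <;> rfl

/-! ### Contact posets -/

namespace ContactPoset

open Structure

instance : Finite (Σ l, lang.Functions l) :=
  Finite.of_injective (fun _ => ()) (by rintro ⟨_, ⟨⟩⟩ ⟨_, ⟨⟩⟩ _; rfl)

instance : Finite (Σ k, lang.Relations k) :=
  Finite.of_surjective (fun b : Bool => if b then ⟨2, Rel.le⟩ else ⟨2, Rel.contact⟩) (by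
    rintro ⟨_, _ | _⟩
    exacts [⟨true, rfl⟩, ⟨false, rfl⟩])

theorem model_iff_isContactOrder (M : Type w) [lang.Structure M] :
    M ⊨ theory ↔ IsContactOrder (Le M) (Contact M) (zero M) := by
  rw [model_theory_iff]
  constructor
  · rintro ⟨h₁, h₂, h₃, h₄, h₅, h₆, h₇, h₈⟩
    exact ⟨h₁, h₂, h₃, h₄, fun a b => (h₅ a b).1, fun a b h => (h₆ a b h).1.2, h₇, h₈⟩
  · rintro ⟨h₁, h₂, h₃, h₄, h₅, h₆, h₇, h₈⟩
    exact ⟨h₁, h₂, h₃, h₄, fun a b => ⟨h₅ a b, h₅ b a⟩,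
      fun a b h => ⟨⟨h₄ a, h₆ a b h⟩, h₄ b, h₆ b a (h₅ a b h)⟩, h₇, h₈⟩

instance : theory.IsUniversal := ⟨by
  intro φ hφ
  have hle : ∀ {n : ℕ} (s t : lang.Term (Empty ⊕ Fin n)), (leF s t).IsQF :=
    fun s t => (BoundedFormula.IsAtomic.rel _ _).isQF
  have hcon : ∀ {n : ℕ} (s t : lang.Term (Empty ⊕ Fin n)), (conF s t).IsQF :=
    fun s t => (BoundedFormula.IsAtomic.rel _ _).isQF
  have heq : ∀ {n : ℕ} (s t : lang.Term (Empty ⊕ Fin n)), (s =' t).IsQF :=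
    fun s t => (BoundedFormula.IsAtomic.equal _ _).isQF
  have hlt : ∀ {n : ℕ} (s t : lang.Term (Empty ⊕ Fin n)), (ltF s t).IsQF :=
    fun s t => (hle s t).inf (heq s t).not
  simp only [theory, Set.mem_insert_iff, Set.mem_singleton_iff] at hφ
  rcases hφ with rfl | rfl | rfl | rfl | rfl | rfl | rfl | rfl
  · exact (hle _ _).isUniversal.all
  · exact (((hle _ _).inf (hle _ _)).imp (hle _ _)).isUniversal.all.all.all
  · exact (((hle _ _).inf (hle _ _)).imp (heq _ _)).isUniversal.all.all
  · exact (hle _ _).isUniversal.all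
  · exact (((hcon _ _).imp (hcon _ _)).inf ((hcon _ _).imp (hcon _ _))).isUniversal.all.all
  · exact ((hcon _ _).imp ((hlt _ _).inf (hlt _ _))).isUniversal.all.all
  · exact ((((hcon _ _).inf (hle _ _)).inf (hle _ _)).imp (hcon _ _)).isUniversal.all.all.all.all
  · exact ((heq _ _).not.imp (hcon _ _)).isUniversal.all⟩

/-- The structure given by a minimum, an order and a contact relation. -/
@[reducible] def mkStructure {D : Type w} (z : D) (le con : D → D → Prop) : lang.Structure D where
  funMap | Func.zero => fun _ => z
  RelMap
    | Rel.le => fun x => le (x 0) (x 1)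
    | Rel.contact => fun x => con (x 0) (x 1)

theorem mkStructure_model {D : Type w} {z : D} {le con : D → D → Prop}
    (h : IsContactOrder le con z) :
    letI := mkStructure z le con
    D ⊨ theory :=
  letI := mkStructure z le con
  (model_iff_isContactOrder D).2 h

/-- A map which preserves the minimum, the order and the contact relation is an embedding. -/
def mkEmbedding {M N : Type w} [lang.Structure M] [lang.Structure N] (f : M → N)
    (hf : Function.Injective f) (h0 : f (zero M) = zero N)
    (hle : ∀ a b, Le N (f a) (f b) ↔ Le M a b)
    (hcon : ∀ a b, Contact N (f a) (f b) ↔ Contact M a b) : M ↪[lang] N where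
  toFun := f
  inj' := hf
  map_fun' := by
    rintro _ ⟨⟩ x
    rw [Subsingleton.elim x default, Subsingleton.elim (f ∘ default) default]
    exact h0
  map_rel' := by
    intro n r x
    cases r
    · exact (iff_of_eq (congrArg (RelMap leSymb) (eq_vecCons (f ∘ x)))).trans
        ((hle _ _).trans (iff_of_eq (congrArg (RelMap leSymb) (eq_vecCons x).symm)))
    · exact (iff_of_eq (congrArg (RelMap contactSymb) (eq_vecCons (f ∘ x)))).trans
        ((hcon _ _).trans (iff_of_eq (congrArg (RelMap contactSymb) (eq_vecCons x).symm)))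

theorem map_zero {M N : Type w} [lang.Structure M] [lang.Structure N] (f : M ↪[lang] N) :
    f (zero M) = zero N :=
  f.map_constants zeroSymb

theorem map_le {M N : Type w} [lang.Structure M] [lang.Structure N] (f : M ↪[lang] N) (a b : M) :
    Le N (f a) (f b) ↔ Le M a b := by
  rw [Le, Le, ← f.map_rel]
  congr! 1
  exact (eq_vecCons (f ∘ ![a, b])).symm

theorem map_contact {M N : Type w} [lang.Structure M] [lang.Structure N] (f : M ↪[lang] N)
    (a b : M) : Contact N (f a) (f b) ↔ Contact M a b := by
  rw [Contact, Contact, ← f.map_rel]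
  congr! 1
  exact (eq_vecCons (f ∘ ![a, b])).symm

theorem superamalgamation : Superamalgamation.{0, 0, w} theory Le := by
  intro A B C hA hB hC f g
  let S : ContactSpan A B C :=
    ⟨Le A, Contact A, zero A, Le B, Contact B, zero B, Le C, Contact C, zero C, f, g,
      (model_iff_isContactOrder A).1 hA, (model_iff_isContactOrder B).1 hB, map_zero f, map_zero g,
      map_le f, map_le g, map_contact f, map_contact g⟩
  let D := {X : Set A × Set B // S.Compatible X}
  let _ : lang.Structure D := mkStructure ⟨S.inl S.zA, S.compatible_inl _⟩
    (fun X Y => X.1 ≤ Y.1) (fun X Y => S.Contact X.1 Y.1)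
  refine ⟨⟨D, inferInstance⟩,
    mkEmbedding (N := D) (fun a => ⟨S.inl a, S.compatible_inl a⟩)
      (fun a a' h => S.inl_injective (congrArg Subtype.val h)) rfl
      (fun a a' => S.inl_le_inl) (fun a a' => S.contact_inl),
    mkEmbedding (N := D) (fun b => ⟨S.inr b, S.compatible_inr b⟩)
      (fun b b' h => S.inr_injective (congrArg Subtype.val h)) (Subtype.ext S.inl_bot.symm)
      (fun b b' => S.inr_le_inr) (fun b b' => S.contact_inr),
    mkStructure_model (S.isContactOrder (fun _ h => h) _), fun c => Subtype.ext (S.inl_f c),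
    fun a b h => S.exists_of_inl_eq_inr (congrArg Subtype.val h),
    fun a b h => S.inl_le_inr.1 h, fun a b h => S.inr_le_inl.1 h⟩

end ContactPoset

/-! ### Contact semilattices -/

/-- The operation `add` is the join for the order `le`. -/
def IsJoin {A : Type*} (le : A → A → Prop) (add : A → A → A) : Prop :=
  ∀ a b c, le (add a b) c ↔ le a c ∧ le b c

namespace IsJoin

variable {A : Type*} {le con : A → A → Prop} {z : A} {add : A → A → A}

theorem eq_of_forall_le (h : IsContactOrder le con z) {a b : A} (hab : ∀ c, le a c ↔ le b c) :
    a = b :=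
  h.antisymm _ _ ((hab b).2 (h.refl b)) ((hab a).1 (h.refl a))

theorem add_eq_right_iff (h : IsContactOrder le con z) (hj : IsJoin le add) {a b : A} :
    add a b = b ↔ le a b := by
  constructor
  · intro hab
    exact ((hj a b b).1 (hab.symm ▸ h.refl b)).1
  · intro hab
    refine eq_of_forall_le h fun c => ?_
    rw [hj]
    exact ⟨fun h => h.2, fun hbc => ⟨h.trans _ _ _ hab hbc, hbc⟩⟩

theorem add_mem_iff (h : IsContactOrder le con z) (hj : IsJoin le add) {s : Set A}
    (hs : ∀ a b, le a b → b ∈ s → a ∈ s) (hadd : ∀ a ∈ s, ∀ b ∈ s, add a b ∈ s) {a b : A} :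
    add a b ∈ s ↔ a ∈ s ∧ b ∈ s := by
  have hab := (hj a b _).1 (h.refl _)
  exact ⟨fun hm => ⟨hs _ _ hab.1 hm, hs _ _ hab.2 hm⟩, fun hm => hadd _ hm.1 _ hm.2⟩

end IsJoin

/-! ### Pairs of ideals and their joins -/

namespace ContactSpan

variable {A B C : Type*} (S : ContactSpan A B C) (addA : A → A → A) (addB : B → B → B)

/-- Compatible pairs of ideals. -/
structure IdealPair (X : Set A × Set B) : Prop extends S.Compatible X where
  addA_mem : ∀ a ∈ X.1, ∀ a' ∈ X.1, addA a a' ∈ X.1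
  addB_mem : ∀ b ∈ X.2, ∀ b' ∈ X.2, addB b b' ∈ X.2

variable {S addA addB}

theorem IdealPair.swap {X : Set A × Set B} (h : S.IdealPair addA addB X) :
    S.swap.IdealPair addB addA X.swap :=
  ⟨h.toCompatible.swap, h.addB_mem, h.addA_mem⟩

/-- The `B`-part is closed under joins because interpolants can be joined in `C` and both embeddings
preserve that join. -/
theorem idealPair_inl {addC : C → C → C} (hA : IsJoin S.leA addA) (hB : IsJoin S.leB addB)
    (hf : ∀ c c', S.f (addC c c') = addA (S.f c) (S.f c'))
    (hg : ∀ c c', S.g (addC c c') = addB (S.g c) (S.g c')) (a : A) :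
    S.IdealPair addA addB (S.inl a) where
  toCompatible := S.compatible_inl a
  addA_mem u hu v hv := (hA u v a).2 ⟨hu, hv⟩
  addB_mem := by
    rintro u ⟨c, huc, hca⟩ v ⟨c', hvc', hca'⟩
    refine ⟨addC c c', ?_, ?_⟩
    · have h := (hB _ _ _).1 (S.hB.refl (addB (S.g c) (S.g c')))
      rw [hg, hB]
      exact ⟨S.hB.trans _ _ _ huc h.1, S.hB.trans _ _ _ hvc' h.2⟩
    · rw [hf, hA]
      exact ⟨hca, hca'⟩

theorem idealPair_inr {addC : C → C → C} (hA : IsJoin S.leA addA) (hB : IsJoin S.leB addB)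
    (hf : ∀ c c', S.f (addC c c') = addA (S.f c) (S.f c'))
    (hg : ∀ c c', S.g (addC c c') = addB (S.g c) (S.g c')) (b : B) :
    S.IdealPair addA addB (S.inr b) :=
  (idealPair_inl (S := S.swap) hB hA hg hf b).swap

variable (S addA addB)

/-- The join of two compatible pairs of ideals. -/
def idealJoin (X Y : {X // S.IdealPair addA addB X}) : {X // S.IdealPair addA addB X} :=
  -- The intersection of all upper bounds: every defining condition, including equality of traces,
  -- passes to intersections.
  ⟨({a | ∀ Z, S.IdealPair addA addB Z → X.1 ≤ Z → Y.1 ≤ Z → a ∈ Z.1},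
    {b | ∀ Z, S.IdealPair addA addB Z → X.1 ≤ Z → Y.1 ≤ Z → b ∈ Z.2}),
    { lowerA := fun a a' h ha' Z hZ hX hY => hZ.lowerA a a' h (ha' Z hZ hX hY)
      lowerB := fun b b' h hb' Z hZ hX hY => hZ.lowerB b b' h (hb' Z hZ hX hY)
      botA := fun _ hZ _ _ => hZ.botA
      botB := fun _ hZ _ _ => hZ.botB
      trace := fun c => forall_congr' fun _ => forall_congr' fun hZ => forall_congr' fun _ =>
        forall_congr' fun _ => hZ.trace c
      addA_mem := fun a ha a' ha' Z hZ hX hY =>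
        hZ.addA_mem a (ha Z hZ hX hY) a' (ha' Z hZ hX hY)
      addB_mem := fun b hb b' hb' Z hZ hX hY =>
        hZ.addB_mem b (hb Z hZ hX hY) b' (hb' Z hZ hX hY) }⟩

theorem isJoin_idealJoin :
    IsJoin (fun X Y : {X // S.IdealPair addA addB X} => X.1 ≤ Y.1) (S.idealJoin addA addB) := by
  intro X Y Z
  constructor
  · intro h
    have hX : X.1 ≤ (S.idealJoin addA addB X Y).1 :=
      Prod.mk_le_mk.2 ⟨fun a ha W _ hXW _ => hXW.1 ha, fun b hb W _ hXW _ => hXW.2 hb⟩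
    have hY : Y.1 ≤ (S.idealJoin addA addB X Y).1 :=
      Prod.mk_le_mk.2 ⟨fun a ha W _ _ hYW => hYW.1 ha, fun b hb W _ _ hYW => hYW.2 hb⟩
    exact ⟨hX.trans h, hY.trans h⟩
  · rintro ⟨hX, hY⟩
    exact Prod.mk_le_mk.2 ⟨fun a ha => ha Z.1 Z.2 hX hY, fun b hb => hb Z.1 Z.2 hX hY⟩

end ContactSpan

namespace ContactSemilattice

open Structure

instance : Finite (Σ l, lang.Functions l) :=
  Finite.of_injective (β := Fin 3) (fun s => match s with
    | ⟨_, Func.zero⟩ => 0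
    | ⟨_, Func.add⟩ => 1) (by rintro ⟨_, ⟨⟩⟩ ⟨_, ⟨⟩⟩ h <;> first | rfl | simp at h)

instance : Finite (Σ k, lang.Relations k) :=
  Finite.of_injective (fun _ => ()) (by rintro ⟨_, ⟨⟩⟩ ⟨_, ⟨⟩⟩ _; rfl)

theorem model_iff_isContactOrder (M : Type w) [lang.Structure M] :
    M ⊨ theory ↔ IsContactOrder (Le M) (Contact M) (zero M) ∧ IsJoin (Le M) (add M) := by
  rw [model_theory_iff]
  constructor
  · rintro ⟨assoc, comm, idem, h₄, h₅, h₆, h₇, h₈⟩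
    have trans : ∀ a b c, Le M a b → Le M b c → Le M a c := by
      intro a b c hab hbc
      unfold Le at hab hbc ⊢
      rw [← hbc, ← assoc, hab]
    refine ⟨⟨idem, trans, fun a b hab hba => ?_, h₄, fun a b => (h₅ a b).1,
      fun a b h => (h₆ a b h).1.2, h₇, h₈⟩, fun a b c => ?_⟩
    · unfold Le at hab hba
      rw [← hba, comm, hab]
    · constructor
      · refine fun h => ⟨trans _ _ _ ?_ h, trans _ _ _ ?_ h⟩
        · unfold Le
          rw [← assoc, idem]
        · unfold Le
          rw [comm a b, ← assoc, idem]
      · rintro ⟨ha, hb⟩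
        unfold Le at ha hb ⊢
        rw [assoc, hb, ha]
  · rintro ⟨h, hj⟩
    refine ⟨fun a b c => ?_, fun a b => ?_, h.refl, h.bot, fun a b => ⟨h.symm a b, h.symm b a⟩,
      fun a b hab => ⟨⟨h.bot a, h.ne_bot a b hab⟩, h.bot b, h.ne_bot b a (h.symm a b hab)⟩, h.ext,
      h.contact_self⟩
    · refine IsJoin.eq_of_forall_le h fun d => ?_
      rw [hj, hj, hj, hj, and_assoc]
    · refine IsJoin.eq_of_forall_le h fun d => ?_
      rw [hj, hj, and_comm]

instance : theory.IsUniversal := ⟨by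
  intro φ hφ
  have heq : ∀ {n : ℕ} (s t : lang.Term (Empty ⊕ Fin n)), (s =' t).IsQF :=
    fun s t => (BoundedFormula.IsAtomic.equal _ _).isQF
  have hle : ∀ {n : ℕ} (s t : lang.Term (Empty ⊕ Fin n)), (leF s t).IsQF := fun s t => heq _ _
  have hcon : ∀ {n : ℕ} (s t : lang.Term (Empty ⊕ Fin n)), (conF s t).IsQF :=
    fun s t => (BoundedFormula.IsAtomic.rel _ _).isQF
  have hlt : ∀ {n : ℕ} (s t : lang.Term (Empty ⊕ Fin n)), (ltF s t).IsQF :=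
    fun s t => (hle s t).inf (heq s t).not
  simp only [theory, Set.mem_insert_iff, Set.mem_singleton_iff] at hφ
  rcases hφ with rfl | rfl | rfl | rfl | rfl | rfl | rfl | rfl
  · exact (heq _ _).isUniversal.all.all.all
  · exact (heq _ _).isUniversal.all.all
  · exact (heq _ _).isUniversal.all
  · exact (hle _ _).isUniversal.all
  · exact (((hcon _ _).imp (hcon _ _)).inf ((hcon _ _).imp (hcon _ _))).isUniversal.all.all
  · exact ((hcon _ _).imp ((hlt _ _).inf (hlt _ _))).isUniversal.all.all
  · exact ((((hcon _ _).inf (hle _ _)).inf (hle _ _)).imp (hcon _ _)).isUniversal.all.all.all.all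
  · exact ((heq _ _).not.imp (hcon _ _)).isUniversal.all⟩

/-- The structure given by a minimum, a join and a contact relation. -/
@[reducible] def mkStructure {D : Type w} (z : D) (add : D → D → D) (con : D → D → Prop) :
    lang.Structure D where
  funMap
    | Func.zero => fun _ => z
    | Func.add => fun x => add (x 0) (x 1)
  RelMap | Rel.contact => fun x => con (x 0) (x 1)

theorem mkStructure_le_iff {D : Type w} {z : D} {add : D → D → D} {le con : D → D → Prop}
    (h : IsContactOrder le con z) (hj : IsJoin le add) (a b : D) :
    letI := mkStructure z add con
    Le D a b ↔ le a b :=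
  hj.add_eq_right_iff h

theorem mkStructure_model {D : Type w} {z : D} {add : D → D → D} {le con : D → D → Prop}
    (h : IsContactOrder le con z) (hj : IsJoin le add) :
    letI := mkStructure z add con
    D ⊨ theory := by
  let _ := mkStructure z add con
  have hle : Le D = le := by
    funext a b
    exact propext (mkStructure_le_iff h hj a b)
  rw [model_iff_isContactOrder, hle]
  exact ⟨h, hj⟩

/-- A map which preserves the minimum, the join and the contact relation is an embedding. -/
def mkEmbedding {M N : Type w} [lang.Structure M] [lang.Structure N] (f : M → N)
    (hf : Function.Injective f) (h0 : f (zero M) = zero N)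
    (hadd : ∀ a b, f (add M a b) = add N (f a) (f b))
    (hcon : ∀ a b, Contact N (f a) (f b) ↔ Contact M a b) : M ↪[lang] N where
  toFun := f
  inj' := hf
  map_fun' := by
    intro n F x
    cases F
    · rw [Subsingleton.elim x default, Subsingleton.elim (f ∘ default) default]
      exact h0
    · exact (congrArg (fun y => f (funMap addSymb y)) (eq_vecCons x)).trans
        ((hadd _ _).trans (congrArg (funMap addSymb) (eq_vecCons (f ∘ x)).symm))
  map_rel' := by
    intro n r x
    cases r
    exact (iff_of_eq (congrArg (RelMap contactSymb) (eq_vecCons (f ∘ x)))).trans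
      ((hcon _ _).trans (iff_of_eq (congrArg (RelMap contactSymb) (eq_vecCons x).symm)))

section

variable {M N : Type w} [lang.Structure M] [lang.Structure N] (f : M ↪[lang] N)

theorem map_zero : f (zero M) = zero N :=
  f.map_constants zeroSymb

theorem map_add (a b : M) : f (add M a b) = add N (f a) (f b) :=
  (f.map_fun addSymb ![a, b]).trans (congrArg (funMap addSymb) (eq_vecCons (f ∘ ![a, b])))

theorem map_le (a b : M) : Le N (f a) (f b) ↔ Le M a b := by
  rw [Le, Le, ← map_add, f.injective.eq_iff]

theorem map_contact (a b : M) : Contact N (f a) (f b) ↔ Contact M a b := by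
  rw [Contact, Contact, ← f.map_rel]
  congr! 1
  exact (eq_vecCons (f ∘ ![a, b])).symm

end

theorem superamalgamation : Superamalgamation.{0, 0, w} theory Le := by
  intro A B C hA hB hC f g
  obtain ⟨hA, hjA⟩ := (model_iff_isContactOrder A).1 hA
  obtain ⟨hB, hjB⟩ := (model_iff_isContactOrder B).1 hB
  let S : ContactSpan A B C :=
    ⟨Le A, Contact A, zero A, Le B, Contact B, zero B, Le C, Contact C, zero C, f, g,
      hA, hB, map_zero f, map_zero g, map_le f, map_le g, map_contact f, map_contact g⟩
  let p := S.IdealPair (add A) (add B)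
  have hl : ∀ a, p (S.inl a) := S.idealPair_inl hjA hjB (map_add f) (map_add g)
  have hr : ∀ b, p (S.inr b) := S.idealPair_inr hjA hjB (map_add f) (map_add g)
  let D := {X : Set A × Set B // p X}
  have hD := S.isContactOrder (p := p) (fun _ h => h.toCompatible) (hl _)
  have hjD := S.isJoin_idealJoin (add A) (add B)
  let _ : lang.Structure D := mkStructure ⟨S.inl S.zA, hl _⟩ (S.idealJoin (add A) (add B))
    (fun X Y => S.Contact X.1 Y.1)
  have hle : ∀ X Y : D, Le D X Y ↔ X.1 ≤ Y.1 := mkStructure_le_iff hD hjD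
  refine ⟨⟨D, inferInstance⟩,
    mkEmbedding (N := D) (fun a => ⟨S.inl a, hl a⟩)
      (fun a a' h => S.inl_injective (congrArg Subtype.val h)) rfl (fun a a' => ?_)
      (fun a a' => S.contact_inl),
    mkEmbedding (N := D) (fun b => ⟨S.inr b, hr b⟩)
      (fun b b' h => S.inr_injective (congrArg Subtype.val h)) (Subtype.ext S.inl_bot.symm)
      (fun b b' => ?_) (fun b b' => S.contact_inr),
    mkStructure_model hD hjD, fun c => Subtype.ext (S.inl_f c),
    fun a b h => S.exists_of_inl_eq_inr (congrArg Subtype.val h),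
    fun a b h => S.inl_le_inr.1 ((hle _ _).1 h), fun a b h => S.inr_le_inl.1 ((hle _ _).1 h)⟩
  -- Both sides have the same upper bounds `Z`, since the ideal `Z.1.1` contains a join iff it
  -- contains both terms.
  · refine IsJoin.eq_of_forall_le hD fun Z => Iff.trans ?_ (hjD _ _ Z).symm
    have hZ := Z.2.toCompatible
    exact hZ.inl_le_iff.trans ((hjA.add_mem_iff hA hZ.lowerA Z.2.addA_mem).trans
      (and_congr hZ.inl_le_iff hZ.inl_le_iff).symm)
  · refine IsJoin.eq_of_forall_le hD fun Z => Iff.trans ?_ (hjD _ _ Z).symm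
    have hZ := Z.2.toCompatible
    exact hZ.inr_le_iff.trans ((hjB.add_mem_iff hB hZ.lowerB Z.2.addB_mem).trans
      (and_congr hZ.inr_le_iff hZ.inr_le_iff).symm)

end ContactSemilattice

/-! ### Finite chains and uniform local finiteness -/

/-- One term for each of the finitely many sets of variables suffices; `invFun` gives a harmless
junk term for sets that no term has. -/
theorem FirstOrder.Language.uniformlyLocallyFinite_of_varFinset {L : Language.{u, v}} {M : Type*}
    [L.Structure M]
    (h : ∀ (n : ℕ) (s t : L.Term (Fin n)), s.varFinset = t.varFinset →
      ∀ x : Fin n → M, s.realize x = t.realize x) : UniformlyLocallyFinite L M := by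
  classical
  intro n
  rcases isEmpty_or_nonempty (L.Term (Fin n)) with hn | hn
  · exact ⟨∅, fun t => isEmptyElim t⟩
  · refine ⟨Finset.univ.image (Function.invFun Term.varFinset), fun t => ⟨_,
      Finset.mem_image_of_mem _ (Finset.mem_univ t.varFinset), h n _ _ ?_⟩⟩
    exact (Function.invFun_eq ⟨t, rfl⟩).symm

/-- A finite chain, with all nonzero elements in contact. -/
theorem isContactOrder_chain (n : ℕ) :
    IsContactOrder (fun a b : ULift.{w} (Fin (n + 1)) => a.down ≤ b.down)
      (fun a b => a ≠ ⟨0⟩ ∧ b ≠ ⟨0⟩) ⟨0⟩ where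
  refl a := le_refl a.down
  trans a b c h h' := le_trans (a := a.down) h h'
  antisymm a b h h' := ULift.ext _ _ (le_antisymm h h')
  bot a := Fin.zero_le a.down
  symm a b := And.symm
  ne_bot a b h := h.1.symm
  ext a b a₁ b₁ h ha hb := by
    refine ⟨?_, ?_⟩
    · rintro rfl
      exact h.1 (ULift.ext _ _ (le_antisymm ha (Fin.zero_le _)))
    · rintro rfl
      exact h.2 (ULift.ext _ _ (le_antisymm hb (Fin.zero_le _)))
  contact_self a h := ⟨h, h⟩

theorem isJoin_chain (n : ℕ) :
    IsJoin (fun a b : ULift.{w} (Fin (n + 1)) => a.down ≤ b.down)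
      (fun a b => ⟨max a.down b.down⟩) :=
  fun _ _ _ => max_le_iff

namespace ContactPoset

open Structure

/-- A term is a variable or `0`; either way its value is the least upper bound of its variables, `0`
having none. -/
theorem uniformlyLocallyFinite (N : Type w) [lang.Structure N] (hN : N ⊨ theory) :
    UniformlyLocallyFinite lang N := by
  have h := (model_iff_isContactOrder N).1 hN
  have key : ∀ (n : ℕ) (t : lang.Term (Fin n)) (x : Fin n → N) (c : N),
      Le N (t.realize x) c ↔ ∀ i ∈ t.varFinset, Le N (x i) c := by
    intro n t x c
    cases t with
    | var i => simp [Term.varFinset]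
    | func f ts =>
      cases f
      have : Le N (zero N) c := h.bot c
      simp only [Term.varFinset]
      refine iff_of_true ?_ (by simp)
      convert! this
      exact congrArg (funMap zeroSymb) (Subsingleton.elim _ _)
  refine uniformlyLocallyFinite_of_varFinset fun n s t hst x => ?_
  exact IsJoin.eq_of_forall_le h fun c => by rw [key, key, hst]

/-- The chain with `n + 1` elements. -/
def chain (n : ℕ) : Bundled.{w} lang.Structure :=
  ⟨ULift.{w} (Fin (n + 1)), mkStructure ⟨0⟩ (fun a b => a.down ≤ b.down)
    (fun a b => a ≠ ⟨0⟩ ∧ b ≠ ⟨0⟩)⟩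

theorem chain_mem (n : ℕ) : chain.{w} n ∈ finiteModels theory :=
  ⟨inferInstanceAs (Finite (ULift (Fin (n + 1)))), mkStructure_model (isContactOrder_chain n)⟩

theorem nonempty_embedding (N : Bundled.{w} lang.Structure) (hN : N ⊨ theory) :
    Nonempty (chain.{w} 0 ↪[lang] N) := by
  have h := (model_iff_isContactOrder N).1 hN
  have h₀ := (model_iff_isContactOrder _).1 (chain_mem.{w} 0).2
  have hsub : Subsingleton (chain.{w} 0) := inferInstanceAs (Subsingleton (ULift (Fin 1)))
  refine ⟨mkEmbedding (fun _ => zero N) (fun a b _ => Subsingleton.elim a b) rfl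
    (fun a b => iff_of_true (h.refl _) (Subsingleton.elim a b ▸ h₀.refl a))
    fun a b => iff_of_false (fun hc => h.ne_bot _ _ hc rfl)
      fun hc => h₀.ne_bot _ _ hc (Subsingleton.elim _ _)⟩

end ContactPoset

namespace ContactSemilattice

open Structure

/-- The value of a term is the join of the variables occurring in it, whatever their order or
multiplicity. -/
theorem uniformlyLocallyFinite (N : Type w) [lang.Structure N] (hN : N ⊨ theory) :
    UniformlyLocallyFinite lang N := by
  obtain ⟨h, hj⟩ := (model_iff_isContactOrder N).1 hN
  have key : ∀ (n : ℕ) (t : lang.Term (Fin n)) (x : Fin n → N) (c : N),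
      Le N (t.realize x) c ↔ ∀ i ∈ t.varFinset, Le N (x i) c := by
    intro n t x c
    induction t with
    | var i => simp [Term.varFinset]
    | func f ts ih =>
      cases f
      · have : Le N (zero N) c := h.bot c
        simp only [Term.varFinset]
        refine iff_of_true ?_ (by simp)
        convert! this
        exact congrArg (funMap zeroSymb) (Subsingleton.elim _ _)
      · have : Term.realize x (Term.func Func.add ts : lang.Term (Fin n)) =
            add N ((ts 0).realize x) ((ts 1).realize x) :=
          congrArg (funMap addSymb) (eq_vecCons _)
        rw [this, hj, ih, ih]
        simp only [Term.varFinset, Finset.mem_biUnion, Finset.mem_univ, true_and]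
        constructor
        · rintro ⟨h₀, h₁⟩ i ⟨k, hk⟩
          fin_cases k
          exacts [h₀ i hk, h₁ i hk]
        · exact fun h => ⟨fun i hi => h i ⟨0, hi⟩, fun i hi => h i ⟨1, hi⟩⟩
  refine uniformlyLocallyFinite_of_varFinset fun n s t hst x => ?_
  exact IsJoin.eq_of_forall_le h fun c => by rw [key, key, hst]

/-- The chain with `n + 1` elements. -/
def chain (n : ℕ) : Bundled.{w} lang.Structure :=
  ⟨ULift.{w} (Fin (n + 1)), mkStructure ⟨0⟩ (fun a b => ⟨max a.down b.down⟩)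
    (fun a b => a ≠ ⟨0⟩ ∧ b ≠ ⟨0⟩)⟩

theorem chain_mem (n : ℕ) : chain.{w} n ∈ finiteModels theory :=
  ⟨inferInstanceAs (Finite (ULift (Fin (n + 1)))),
    mkStructure_model (isContactOrder_chain n) (isJoin_chain n)⟩

theorem nonempty_embedding (N : Bundled.{w} lang.Structure) (hN : N ⊨ theory) :
    Nonempty (chain.{w} 0 ↪[lang] N) := by
  have h := ((model_iff_isContactOrder N).1 hN).1
  have h₀ := ((model_iff_isContactOrder _).1 (chain_mem.{w} 0).2).1
  have hsub : Subsingleton (chain.{w} 0) := inferInstanceAs (Subsingleton (ULift (Fin 1)))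
  exact ⟨mkEmbedding (fun _ => zero N) (fun a b _ => Subsingleton.elim a b) rfl
    (fun a b => (h.refl _).symm)
    fun a b => iff_of_false (fun hc => h.ne_bot _ _ hc rfl)
      fun hc => h₀.ne_bot _ _ hc (Subsingleton.elim _ _)⟩

end ContactSemilattice

/-! ### The theorem for posets and for semilattices -/

theorem theorem5 :
    (Superamalgamation.{0, 0, w} ContactPoset.theory ContactPoset.Le ∧
      ∃ (M : Type w) (_ : ContactPoset.lang.Structure M) (_ : Countable M),
        IsFraisseLimit (finiteModels.{0, 0, w} ContactPoset.theory) M ∧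
        Theory.IsOmegaCategorical.{0, 0, w} (ContactPoset.lang.completeTheory M) ∧
        Theory.HasQuantifierElimination (ContactPoset.lang.completeTheory M) ∧
        Theory.IsModelCompletion.{0, 0, w} (ContactPoset.lang.completeTheory M)
          ContactPoset.theory) ∧
    (Superamalgamation.{0, 0, w} ContactSemilattice.theory ContactSemilattice.Le ∧
      ∃ (M : Type w) (_ : ContactSemilattice.lang.Structure M) (_ : Countable M),
        IsFraisseLimit (finiteModels.{0, 0, w} ContactSemilattice.theory) M ∧
        Theory.IsOmegaCategorical.{0, 0, w} (ContactSemilattice.lang.completeTheory M) ∧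
        Theory.HasQuantifierElimination (ContactSemilattice.lang.completeTheory M) ∧
        Theory.IsModelCompletion.{0, 0, w} (ContactSemilattice.lang.completeTheory M)
          ContactSemilattice.theory) := by
  refine ⟨⟨ContactPoset.superamalgamation, ?_⟩, ContactSemilattice.superamalgamation, ?_⟩
  · refine exists_isFraisseLimit_isModelCompletion ContactPoset.uniformlyLocallyFinite
      ContactPoset.superamalgamation _ (ContactPoset.chain_mem 0) ContactPoset.nonempty_embedding
      fun n => ⟨_, ContactPoset.chain_mem n, ?_⟩
    change n < Nat.card (ULift (Fin (n + 1)))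
    simp
  · refine exists_isFraisseLimit_isModelCompletion ContactSemilattice.uniformlyLocallyFinite
      ContactSemilattice.superamalgamation _ (ContactSemilattice.chain_mem 0)
      ContactSemilattice.nonempty_embedding fun n => ⟨_, ContactSemilattice.chain_mem n, ?_⟩
    change n < Nat.card (ULift (Fin (n + 1)))
    simp
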